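/- **Setting.** Let $\mathcal V=\{x_1,\dots,x_d\}$ with $d\in\mathbb N$. A *loop* $(\varphi,\eta)$ over $\mathcal V$ consists of a guard $\varphi$, which is built by $\wedge$ and $\vee$ from inequations $p>0$ with $p\in\mathbb Q[\mathcal V]$, and an update $\eta:\mathcal V\to\mathbb Z[\mathcal V]$. Applying $\eta$ to a polynomial or formula means replacing every variable $v$ by $\eta(v)$, and $\eta^n$ is the $n$-fold application. A *state* is a map $\sigma:\mathcal V\to\mathbb Z$; $\sigma(\cdot)$ denotes evaluation and $|\sigma|(x)=|\sigma(x)|$. The loop is *terminating* if for every state $\sigma$ there is an $n\in\mathbb N$ such that $\sigma(\eta^n(\varphi))$ is false. Its *runtime complexity* is $\mathrm{rc}(\sigma)=\inf\{n\in\mathbb N\mid \sigma(\eta^n(\neg\varphi))\}\in\mathbb N\cup\{\omega\}$, with $\inf\emptyset=\omega$. The set $\mathcal B$ of *bounds* is the smallest set of expressions that contains $\mathbb N\cup\{\omega\}$ and $\mathcal V$ and that contains $b_1+b_2$, $b_1\cdot b_2$ and $k^{b_1}$ for all $b_1,b_2\in\mathcal B$ and $k\in\mathbb N$. A bound is *finite*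 if $\omega$ does not occur in it, and *polynomial* if it is built only from natural numbers and variables by $+$ and $\cdot$. A *runtime bound* is an $r\in\mathcal B$ with $|\sigma|(r)\ge \mathrm{rc}(\sigma)$ for all states $\sigma$. A *size bound* is a map $\mathcal{SB}:\mathcal V\to\mathcal B$ with $|\sigma|(\mathcal{SB}(x))\ge\sup\{|\sigma(\eta^n(x))|\mid n\in\mathbb N,\ n\le \mathrm{rc}(\sigma)\}$ for all $x\in\mathcal V$ and all states $\sigma$. The loop is *solvable* if there is a partition $\mathcal S_1,\dots,\mathcal S_m$ of $\mathcal V$ such that for every $i$ we have $\vec\eta_{\mathcal S_i}=A_{\mathcal S_i}\cdot\vec x_{\mathcal S_i}+\vec p_{\mathcal S_i}$ with $A_{\mathcal S_i}\in\mathbb Z^{|\mathcal S_i|\times|\mathcal S_i|}$ and $\vec p_{\mathcal S_i}\in\mathbb Z[\bigcup_{j<i}\mathcal S_j]^{|\mathcal S_i|}$, where $\vec\eta_{\mathcal S_i}$ and $\vec x_{\mathcal S_i}$ are the vectors of all $\eta(x)$ and of all $x$ with $x\in\mathcal S_i$. Its *eigenvalues* are the complex eigenvalues of the matrices $A_{\mathcal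 S_i}$ (they do not depend on the partition). A *periodic rational solvable (prs) loop* is a solvable loop such that for each of its eigenvalues $\lambda$ there is an integer $p>0$ with $\lambda^p\in\mathbb Q$. A prs loop is *unit* if $|\lambda|\le 1$ for all its eigenvalues $\lambda$. **Theorem (Completeness of Size and Runtime Bound Computation for Terminating PRS Loops).** There are two algorithms (partial recursive functions) whose input is a number $d$ and a description of a loop over $x_1,\dots,x_d$, in which the polynomials are given as lists of coefficients and exponent vectors. For every terminating prs loop, and for each of its descriptions, 1. the first algorithm halts and outputs a polynomial runtime bound of the loop; 2. the second algorithm halts and outputs a size bound $(\mathcal{SB}(x_1),\dots,\mathcal{SB}(x_d))$ of the loop, in which every $\mathcal{SB}(x_i)$ is finite. If the loop is moreover unit, then every $\mathcal{SB}(x_i)$ in this output is polynomial. -/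

import Mathlib

namespace PRS

/-! ### Formulas -/

/-- Formulas built with `∧` and `∨` from atoms `p > 0`. The parameter `α` is the type of the
polynomials `p`, or of finite descriptions of them. -/
inductive Formula (α : Type) : Type
  | pos : α → Formula α
  | and : Formula α → Formula α → Formula α
  | or : Formula α → Formula α → Formula α

namespace Formula

/-- Replace every atom `p > 0` by `f p > 0`. -/
def map {α β : Type} (f : α → β) : Formula α → Formula β
  | pos p => pos (f p)
  | and φ ψ => and (map f φ) (map f ψ)
  | or φ ψ => or (map f φ) (map f ψ)

/-- The truth value `σ(φ)` of a formula in the state `σ`. -/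
def Holds {d : ℕ} (σ : Fin d → ℤ) : Formula (MvPolynomial (Fin d) ℚ) → Prop
  | pos p => 0 < MvPolynomial.eval (fun i => (σ i : ℚ)) p
  | and φ ψ => Holds σ φ ∧ Holds σ ψ
  | or φ ψ => Holds σ φ ∨ Holds σ ψ

end Formula

/-! ### Loops -/

/-- A loop over the variables `x_i`, `i : Fin d`: a guard over `ℚ[x]` and an update by
polynomials in `ℤ[x]`. -/
structure Loop (d : ℕ) where
  guard : Formula (MvPolynomial (Fin d) ℚ)
  update : Fin d → MvPolynomial (Fin d) ℤ

namespace Loop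

variable {d : ℕ}

/-- The polynomial `η^n(x_i)`: the `n`-fold substitution of `η` in the variable `x_i`. -/
noncomputable def iter (L : Loop d) (n : ℕ) (i : Fin d) : MvPolynomial (Fin d) ℤ :=
  (MvPolynomial.bind₁ L.update)^[n] (MvPolynomial.X i)

/-- The formula `η^n(φ)`: the `n`-fold substitution of the update in the guard. -/
noncomputable def iterGuard (L : Loop d) (n : ℕ) : Formula (MvPolynomial (Fin d) ℚ) :=
  (Formula.map (MvPolynomial.bind₁ fun i =>
    MvPolynomial.map (Int.castRingHom ℚ) (L.update i)))^[n] L.guard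

/-- Termination on `ℤ^d`: from every integer state the guard is violated at some point. -/
def Terminates (L : Loop d) : Prop :=
  ∀ σ : Fin d → ℤ, ∃ n : ℕ, ¬ (L.iterGuard n).Holds σ

/-- The runtime complexity `inf {n | σ(η^n(¬φ))}`, with `inf ∅ = ⊤` (usually written `ω`). -/
noncomputable def rc (L : Loop d) (σ : Fin d → ℤ) : ℕ∞ :=
  sInf {t : ℕ∞ | ∃ n : ℕ, t = n ∧ ¬ (L.iterGuard n).Holds σ}

end Loop

/-! ### Bounds -/

/-- The expressions used as bounds, over the variables `V`: natural numbers and `ω`, variables,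
sums, products, and `k ^ b` for a natural number `k`. -/
inductive Bound (V : Type) : Type
  | omega : Bound V
  | const : ℕ → Bound V
  | var : V → Bound V
  | add : Bound V → Bound V → Bound V
  | mul : Bound V → Bound V → Bound V
  | exp : ℕ → Bound V → Bound V

namespace Bound

variable {V W : Type}

/-- Renaming of variables. -/
def map (f : V → W) : Bound V → Bound W
  | omega => omega
  | const n => const n
  | var v => var (f v)
  | add a b => add (map f a) (map f b)
  | mul a b => mul (map f a) (map f b)
  | exp k b => exp k (map f b)

/-- The value of a bound for given natural values of the variables. -/
noncomputable def eval (s : V → ℕ) : Bound V → ℕ∞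
  | omega => ⊤
  | const n => (n : ℕ∞)
  | var v => (s v : ℕ∞)
  | add a b => eval s a + eval s b
  | mul a b => eval s a * eval s b
  | exp k b => (k : ℕ∞) ^ eval s b

/-- Finite bounds: expressions in which `ω` does not occur. -/
def IsFinite : Bound V → Prop
  | omega => False
  | const _ => True
  | var _ => True
  | add a b => IsFinite a ∧ IsFinite b
  | mul a b => IsFinite a ∧ IsFinite b
  | exp _ b => IsFinite b

/-- Polynomial bounds: expressions built from natural numbers and variables by `+` and `·`. -/
def IsPolynomial : Bound V → Prop
  | omega => False
  | const _ => True
  | var _ => True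
  | add a b => IsPolynomial a ∧ IsPolynomial b
  | mul a b => IsPolynomial a ∧ IsPolynomial b
  | exp _ _ => False

end Bound

namespace Loop

variable {d : ℕ}

/-- `r` is a runtime bound: `|σ|(r) ≥ rc(σ)` for all states `σ`. -/
def IsRuntimeBound (L : Loop d) (r : Bound (Fin d)) : Prop :=
  ∀ σ : Fin d → ℤ, L.rc σ ≤ r.eval fun j => (σ j).natAbs

/-- `s` is a size bound: `|σ|(s(x)) ≥ sup {|σ(η^n(x))| : n ≤ rc(σ)}` for all `x` and `σ`. -/
def IsSizeBound (L : Loop d) (s : Fin d → Bound (Fin d)) : Prop :=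
  ∀ (i : Fin d) (σ : Fin d → ℤ),
    sSup {t : ℕ∞ | ∃ n : ℕ, (n : ℕ∞) ≤ L.rc σ ∧
      t = ((MvPolynomial.eval σ (L.iter n i)).natAbs : ℕ∞)} ≤
    (s i).eval fun j => (σ j).natAbs

/-! ### Solvable loops and their eigenvalues -/

/-- A partition of the variables into blocks `S_0, …, S_{m-1}` witnessing that the update is
solvable: on the block `S_i` the update is `A_i · x_{S_i} + p_{S_i}` with an integer matrix `A_i`
and integer polynomials `p_{S_i}` in the variables of the blocks with lower indices. -/
structure SolvablePartition (L : Loop d) where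
  m : ℕ
  block : Fin d → Fin m
  block_surjective : Function.Surjective block
  A : (i : Fin m) → Matrix {j : Fin d // block j = i} {j : Fin d // block j = i} ℤ
  p : Fin d → MvPolynomial (Fin d) ℤ
  p_vars : ∀ j : Fin d, ∀ k ∈ (p j).vars, block k < block j
  update_eq : ∀ (i : Fin m) (j : {j : Fin d // block j = i}),
    L.update j = (∑ k, MvPolynomial.C (A i j k) * MvPolynomial.X (k : Fin d)) + p j

/-- `z` is an eigenvalue of one of the block matrices of the partition. -/
def SolvablePartition.IsEigenvalue {L : Loop d} (P : L.SolvablePartition) (z : ℂ) : Prop :=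
  ∃ i : Fin P.m,
    Module.End.HasEigenvalue (Matrix.toLin' ((P.A i).map fun a : ℤ => (a : ℂ))) z

end Loop

/-- `z` is periodic rational: some positive power of it is a rational number. -/
def IsPeriodicRational (z : ℂ) : Prop :=
  ∃ p : ℕ, 0 < p ∧ ∃ q : ℚ, z ^ p = (q : ℂ)

namespace Loop

variable {d : ℕ}

/-- Periodic rational solvable loops. (The eigenvalues of a solvable loop do not depend on the
choice of the partition: the product of the characteristic polynomials of its blocks is the
characteristic polynomial of the Jacobian matrix of the update.) -/
def IsPRS (L : Loop d) : Prop :=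
  ∃ P : L.SolvablePartition, ∀ z : ℂ, P.IsEigenvalue z → IsPeriodicRational z

/-- Unit prs loops: all eigenvalues are periodic rational and of absolute value at most `1`. -/
def IsUnitPRS (L : Loop d) : Prop :=
  ∃ P : L.SolvablePartition, ∀ z : ℂ, P.IsEigenvalue z → IsPeriodicRational z ∧ ‖z‖ ≤ 1

end Loop

/-! ### Finite descriptions of loops, as inputs of algorithms -/

/-- The monomial `∏_{i < d} x_i ^ (e_i)` with the exponents given by a list (padded with `0`). -/
noncomputable def monomialOf (R : Type) [CommSemiring R] (d : ℕ) (e : List ℕ) :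
    MvPolynomial (Fin d) R :=
  ∏ i : Fin d, MvPolynomial.X i ^ e.getD i 0

/-- The integer polynomial described by a list of coefficients and exponent vectors. -/
noncomputable def intPolyOf (d : ℕ) (l : List (ℤ × List ℕ)) : MvPolynomial (Fin d) ℤ :=
  (l.map fun t => MvPolynomial.C t.1 * monomialOf ℤ d t.2).sum

/-- The rational polynomial described by a list of coefficients and exponent vectors, where
`(a, b)` stands for the coefficient `a / (b + 1)`. -/
noncomputable def ratPolyOf (d : ℕ) (l : List ((ℤ × ℕ) × List ℕ)) : MvPolynomial (Fin d) ℚ :=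
  (l.map fun t =>
    MvPolynomial.C ((t.1.1 : ℚ) / ((t.1.2 : ℚ) + 1)) * monomialOf ℚ d t.2).sum

/-- Descriptions of loops: a guard with explicitly given rational polynomials, and the list of
the explicitly given integer polynomials of the update. -/
abbrev LoopRep : Type := Formula (List ((ℤ × ℕ) × List ℕ)) × List (List (ℤ × List ℕ))

/-- The loop in `d` variables that a description stands for. -/
noncomputable def LoopRep.toLoop (d : ℕ) (c : LoopRep) : Loop d where
  guard := c.1.map (ratPolyOf d)
  update := fun i => intPolyOf d (c.2.getD i [])

/-! ### Numbering of formulas and bounds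

Mathlib's `Partrec` needs an effective numbering of the inputs and outputs. -/

namespace Formula

variable {α : Type} [Denumerable α]

/-- The Gödel number of a formula. -/
def encodeNat : Formula α → ℕ
  | pos p => 3 * Encodable.encode p
  | and φ ψ => 3 * Nat.pair (encodeNat φ) (encodeNat ψ) + 1
  | or φ ψ => 3 * Nat.pair (encodeNat φ) (encodeNat ψ) + 2

/-- The formula with a given Gödel number. -/
def ofNat (n : ℕ) : Formula α :=
  if n % 3 = 0 then pos (Denumerable.ofNat α (n / 3))
  else
    if n % 3 = 1 then and (ofNat (n / 3).unpair.1) (ofNat (n / 3).unpair.2)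
    else or (ofNat (n / 3).unpair.1) (ofNat (n / 3).unpair.2)
termination_by n
decreasing_by
  all_goals
    have h1 := Nat.unpair_left_le (n / 3)
    have h2 := Nat.unpair_right_le (n / 3)
    omega

theorem ofNat_encodeNat (φ : Formula α) : ofNat (encodeNat φ) = φ := by
  induction φ with
  | pos p => rw [encodeNat, ofNat]; simp
  | and φ ψ h1 h2 =>
    rw [encodeNat, ofNat]
    have e1 : (3 * Nat.pair φ.encodeNat ψ.encodeNat + 1) % 3 = 1 := by omega
    have e2 : (3 * Nat.pair φ.encodeNat ψ.encodeNat + 1) / 3 =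
      Nat.pair φ.encodeNat ψ.encodeNat := by omega
    simp [e1, e2, h1, h2]
  | or φ ψ h1 h2 =>
    rw [encodeNat, ofNat]
    have e1 : (3 * Nat.pair φ.encodeNat ψ.encodeNat + 2) % 3 = 2 := by omega
    have e2 : (3 * Nat.pair φ.encodeNat ψ.encodeNat + 2) / 3 =
      Nat.pair φ.encodeNat ψ.encodeNat := by omega
    simp [e1, e2, h1, h2]

theorem encodeNat_ofNat (n : ℕ) : encodeNat (ofNat n : Formula α) = n := by
  induction n using Nat.strong_induction_on with
  | _ n ih =>
    have h1 := Nat.unpair_left_le (n / 3)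
    have h2 := Nat.unpair_right_le (n / 3)
    rw [ofNat]
    split_ifs with h h'
    · simp only [encodeNat, Denumerable.encode_ofNat]; omega
    · rw [encodeNat, ih _ (by omega), ih _ (by omega), Nat.pair_unpair]; omega
    · rw [encodeNat, ih _ (by omega), ih _ (by omega), Nat.pair_unpair]; omega

instance instDenumerable : Denumerable (Formula α) :=
  Denumerable.mk' ⟨encodeNat, ofNat, ofNat_encodeNat, encodeNat_ofNat⟩

end Formula

namespace Bound

/-- The Gödel number of a bound. -/
def encodeNat : Bound ℕ → ℕ
  | omega => 0
  | const n => 5 * n + 1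
  | var i => 5 * i + 2
  | add a b => 5 * Nat.pair (encodeNat a) (encodeNat b) + 3
  | mul a b => 5 * Nat.pair (encodeNat a) (encodeNat b) + 4
  | exp k b => 5 * Nat.pair k (encodeNat b) + 5

/-- The bound with a given Gödel number. -/
def ofNat : ℕ → Bound ℕ
  | 0 => omega
  | n + 1 =>
    if n % 5 = 0 then const (n / 5)
    else if n % 5 = 1 then var (n / 5)
    else if n % 5 = 2 then add (ofNat (n / 5).unpair.1) (ofNat (n / 5).unpair.2)
    else if n % 5 = 3 then mul (ofNat (n / 5).unpair.1) (ofNat (n / 5).unpair.2)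
    else exp (n / 5).unpair.1 (ofNat (n / 5).unpair.2)
termination_by n => n
decreasing_by
  all_goals
    have h1 := Nat.unpair_left_le (n / 5)
    have h2 := Nat.unpair_right_le (n / 5)
    omega

theorem ofNat_encodeNat (b : Bound ℕ) : ofNat (encodeNat b) = b := by
  have key : ∀ k r : ℕ, r < 5 → (5 * k + r) % 5 = r ∧ (5 * k + r) / 5 = k := by
    intro k r hr; omega
  induction b with
  | omega => rw [encodeNat, ofNat]
  | const n => rw [encodeNat, ofNat]; simp
  | var n => rw [encodeNat, ofNat]; simp [key n 1 (by omega)]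
  | add a b h1 h2 =>
    rw [encodeNat, ofNat]; simp [key _ 2 (by omega), h1, h2]
  | mul a b h1 h2 =>
    rw [encodeNat, ofNat]; simp [key _ 3 (by omega), h1, h2]
  | exp k b h =>
    rw [encodeNat, ofNat]; simp [key _ 4 (by omega), h]

theorem encodeNat_ofNat (n : ℕ) : encodeNat (ofNat n) = n := by
  induction n using Nat.strong_induction_on with
  | _ n ih =>
    cases n with
    | zero => rw [ofNat, encodeNat]
    | succ n =>
      have h1 := Nat.unpair_left_le (n / 5)
      have h2 := Nat.unpair_right_le (n / 5)
      rw [ofNat]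
      split_ifs
      · rw [encodeNat]; omega
      · rw [encodeNat]; omega
      · rw [encodeNat, ih _ (by omega), ih _ (by omega), Nat.pair_unpair]; omega
      · rw [encodeNat, ih _ (by omega), ih _ (by omega), Nat.pair_unpair]; omega
      · rw [encodeNat, ih _ (by omega), Nat.pair_unpair]; omega

instance instDenumerable : Denumerable (Bound ℕ) :=
  Denumerable.mk' ⟨encodeNat, ofNat, ofNat_encodeNat, encodeNat_ofNat⟩

end Bound

end PRS

/-! Along an orbit of a prs loop, the value of every variable and every guard atom satisfies an
integer linear recurrence. With P the common period of the eigenvalues, every P-th power of an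
eigenvalue is a natural number (`pow_period_eq_nat`). Hence these values are annihilated by a power
of ∏_{b ≤ B} (E^P - b), where E is the shift. The class `cls P B R` of such sequences is closed
under products (`mul_mem_cls`) and under solving linear systems (`mem_cls_of_linear_system`).
Induction over the blocks therefore puts all orbits into one class with explicit B and R
(`orbit_mem_cls`).

On a residue class mod P such a sequence is an integer recurrence whose characteristic roots are
natural numbers. Its sign is eventually that of its dominant term. The leading coefficient, scaled
suitably, is a nonzero integer, so it has absolute value at least 1. The time at which the dominant
term wins is therefore polynomial in the first values (`sign_constant_of_mem_cls`), and these are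
polynomial in the start state.

Consequently the truth value of the guard is constant on each residue class after a time T
polynomial in the state. If the guard held up to time P (T + 1), it would hold forever. For a
terminating loop this makes P (T + 1) a runtime bound (`rc_le`).

Before that time, crude degree growth bounds all values by a tower, which gives a finite size bound.
If all P-th powers of eigenvalues are 0 or 1, the values grow only polynomially in time, so
composing with the runtime bound gives a polynomial size bound (`natAbs_iterate_le_of_unitTest`).
This case is recognised by the nilpotency of J^P (J^P - 1) for the matrix J of linear coefficients
of the update, which requires no partition (`charpoly_jac`).

Every constant depends on one number N that bounds the data of the loop and is computed from the
code of the description. Neither termination nor the prs property has to be decided, and both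
algorithms are primitive recursive. -/

namespace PRS

open Polynomial

/-! ### Sequences annihilated by polynomials in the shift -/

/-- The shift operator on integer sequences. -/
def shift : Module.End ℤ (ℕ → ℤ) where
  toFun u n := u (n + 1)
  map_add' _ _ := rfl
  map_smul' _ _ := rfl

theorem shift_apply (u : ℕ → ℤ) (n : ℕ) : shift u n = u (n + 1) := rfl

theorem shift_pow_apply (P : ℕ) (u : ℕ → ℤ) (n : ℕ) : (shift ^ P) u n = u (n + P) := by
  induction P generalizing n with
  | zero => simp
  | succ k ih => rw [pow_succ', Module.End.mul_apply, shift_apply, ih]; congr 1; omega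

theorem shift_pow_mul (P : ℕ) (u v : ℕ → ℤ) :
    (shift ^ P) (u * v) = (shift ^ P) u * (shift ^ P) v := by
  ext n; simp [shift_pow_apply]

/-- The polynomial `X (X - 1) ⋯ (X - B)`. -/
noncomputable def rootProd (B : ℕ) : ℤ[X] := ∏ b ∈ Finset.range (B + 1), (X - C (b : ℤ))

theorem X_sub_dvd_rootProd {b B : ℕ} (h : b ≤ B) : (X - C (b : ℤ)) ∣ rootProd B :=
  Finset.dvd_prod_of_mem (fun b : ℕ => X - C (b : ℤ)) (Finset.mem_range.2 (by omega))

theorem rootProd_dvd {B B' : ℕ} (h : B ≤ B') : rootProd B ∣ rootProd B' :=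
  Finset.prod_dvd_prod_of_subset _ _ _ (Finset.range_mono (by omega))

/-- The sequences that are annihilated by `(X (X - 1) ⋯ (X - B)) ^ R` evaluated at the `P`-fold
shift. -/
noncomputable def cls (P B R : ℕ) : Submodule ℤ (ℕ → ℤ) :=
  LinearMap.ker (aeval (shift ^ P) (rootProd B ^ R))

theorem mem_cls {P B R : ℕ} {u : ℕ → ℤ} :
    u ∈ cls P B R ↔ aeval (shift ^ P) (rootProd B ^ R) u = 0 := LinearMap.mem_ker

theorem aeval_eq_zero_of_dvd {T : Module.End ℤ (ℕ → ℤ)} {f g : ℤ[X]} {u : ℕ → ℤ} (h : f ∣ g)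
    (hf : aeval T f u = 0) : aeval T g u = 0 := by
  obtain ⟨k, rfl⟩ := h
  rw [mul_comm, map_mul, Module.End.mul_apply, hf, map_zero]

theorem cls_mono {P B R B' R' : ℕ} (hB : B ≤ B') (hR : R ≤ R') : cls P B R ≤ cls P B' R' :=
  fun _ hu => mem_cls.2 (aeval_eq_zero_of_dvd
    ((pow_dvd_pow _ hR).trans (pow_dvd_pow_of_dvd (rootProd_dvd hB) _)) (mem_cls.1 hu))

/-- All polynomials in the shift commute; `expand` writes a polynomial in E^P as a polynomial in E.
-/
theorem aeval_apply_mem_cls {P B R : ℕ} {u : ℕ → ℤ} (f : ℤ[X]) (hu : u ∈ cls P B R) :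
    aeval shift f u ∈ cls P B R := by
  rw [mem_cls] at *
  rw [← expand_aeval] at *
  rw [← Module.End.mul_apply, ← map_mul, mul_comm, map_mul, Module.End.mul_apply, hu, map_zero]

/-- The polynomial with the given list of roots. -/
noncomputable def listProd (S : List ℕ) : ℤ[X] := (S.map fun b : ℕ => X - C (b : ℤ)).prod

theorem listProd_cons (b : ℕ) (S : List ℕ) : listProd (b :: S) = (X - C (b : ℤ)) * listProd S := by
  simp [listProd]

/-- A discrete Leibniz rule: for T = E^P, (T - ab)(uv) = (T - a)u · Tv + a · u · (T - b)v. Each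
summand has one linear factor fewer to kill, so the induction runs on the total number of factors.
-/
theorem mul_mem_ker_of_listProd {P B B' : ℕ} (n : ℕ) : ∀ (S S' : List ℕ) (u v : ℕ → ℤ),
    S.length + S'.length ≤ n → (∀ b ∈ S, b ≤ B) → (∀ b ∈ S', b ≤ B') →
    aeval (shift ^ P) (listProd S) u = 0 → aeval (shift ^ P) (listProd S') v = 0 →
    u * v ∈ cls P (B * B') n := by
  induction n with
  | zero =>
    intro S S' u v hn _ _ hu _
    have : S = [] := List.eq_nil_of_length_eq_zero (by omega)
    subst this
    have : u = 0 := by simpa [listProd] using hu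
    rw [this, zero_mul]; exact zero_mem _
  | succ n ih =>
    intro S S' u v hn hS hS' hu hv
    -- An empty list stands for the operator 1, so the sequence is zero.
    rcases S with _ | ⟨a, S⟩
    · have : u = 0 := by simpa [listProd] using hu
      rw [this, zero_mul]; exact zero_mem _
    rcases S' with _ | ⟨b, S'⟩
    · have : v = 0 := by simpa [listProd] using hv
      rw [this, mul_zero]; exact zero_mem _
    simp only [List.length_cons] at hn
    have hab : a * b ≤ B * B' :=
      Nat.mul_le_mul (hS a (by simp)) (hS' b (by simp))
    set T := shift ^ P with hT
    set u' := T u - (a : ℤ) • u with hu'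
    set v' := T v - (b : ℤ) • v with hv'
    have e1 : ∀ (c : ℕ) (w : ℕ → ℤ), aeval T (X - C (c : ℤ)) w = T w - (c : ℤ) • w := by
      intro c w
      simp
    have k1 : aeval T (listProd S) u' = 0 := by
      rw [listProd_cons, mul_comm, map_mul, Module.End.mul_apply, e1] at hu
      exact hu
    have k2 : aeval T (listProd S') v' = 0 := by
      rw [listProd_cons, mul_comm, map_mul, Module.End.mul_apply, e1] at hv
      exact hv
    have k3 : aeval T (listProd (b :: S')) (T v) = 0 := by
      have : T v = aeval T (X : ℤ[X]) v := by simp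
      rw [this, ← Module.End.mul_apply, ← map_mul, mul_comm, map_mul, Module.End.mul_apply, hv,
        map_zero]
    have m1 := ih S (b :: S') u' (T v) (by simp only [List.length_cons]; omega)
      (fun c hc => hS c (by simp [hc])) hS' k1 k3
    have m2 := ih (a :: S) S' u v' (by simp only [List.length_cons]; omega) hS
      (fun c hc => hS' c (by simp [hc])) hu k2
    have key : aeval T (X - C ((a * b : ℕ) : ℤ)) (u * v) = u' * T v + (a : ℤ) • (u * v') := by
      rw [e1, hT, shift_pow_mul, ← hT, hu', hv']
      ext n
      simp
      ring
    have m3 : aeval T (X - C ((a * b : ℕ) : ℤ)) (u * v) ∈ cls P (B * B') n := by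
      rw [key]
      exact add_mem m1 (Submodule.smul_mem _ _ m2)
    rw [mem_cls, ← Module.End.mul_apply, ← map_mul] at m3
    refine mem_cls.2 (aeval_eq_zero_of_dvd ?_ m3)
    rw [pow_succ]
    exact mul_dvd_mul dvd_rfl (X_sub_dvd_rootProd hab)

theorem rootProd_pow_eq_listProd (B R : ℕ) : ∃ S : List ℕ, S.length = (B + 1) * R ∧
    (∀ b ∈ S, b ≤ B) ∧ rootProd B ^ R = listProd S := by
  induction R with
  | zero => exact ⟨[], by simp, by simp, by simp [listProd]⟩
  | succ R ih =>
    obtain ⟨S, h1, h2, h3⟩ := ih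
    refine ⟨S ++ List.range (B + 1), by simp [h1]; ring, ?_, ?_⟩
    · intro b hb
      rcases List.mem_append.1 hb with h | h
      · exact h2 b h
      · have := List.mem_range.1 h; omega
    · have : rootProd B = listProd (List.range (B + 1)) := by
        rw [rootProd, listProd, ← Multiset.prod_coe]
        rfl
      rw [pow_succ, h3, this, listProd, listProd, listProd, List.map_append, List.prod_append]

theorem mul_mem_cls {P B R B' R' : ℕ} {u v : ℕ → ℤ} (hu : u ∈ cls P B R) (hv : v ∈ cls P B' R') :
    u * v ∈ cls P (B * B') ((B + 1) * R + (B' + 1) * R') := by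
  obtain ⟨S, h1, h2, h3⟩ := rootProd_pow_eq_listProd B R
  obtain ⟨S', h1', h2', h3'⟩ := rootProd_pow_eq_listProd B' R'
  rw [mem_cls, h3] at hu
  rw [mem_cls, h3'] at hv
  exact mul_mem_ker_of_listProd _ S S' u v (by rw [h1, h1']) h2 h2' hu hv

theorem one_mem_cls (P : ℕ) {B R : ℕ} (hB : 1 ≤ B) (hR : 1 ≤ R) : (1 : ℕ → ℤ) ∈ cls P B R := by
  refine mem_cls.2 (aeval_eq_zero_of_dvd (f := X - C ((1 : ℕ) : ℤ))
    ((X_sub_dvd_rootProd hB).trans (dvd_pow_self _ (by omega))) ?_)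
  ext n
  simp [shift_pow_apply]

/-- The multiplicity needed for products of `D` sequences of `cls P B R`. -/
def prodMult (B R : ℕ) : ℕ → ℕ
  | 0 => 1
  | D + 1 => (B + 1) * R + (B ^ D + 1) * prodMult B R D

theorem prodMult_mono (B R : ℕ) : Monotone (prodMult B R) := by
  refine monotone_nat_of_le_succ fun D => ?_
  rw [prodMult]
  nlinarith [Nat.zero_le ((B + 1) * R), Nat.zero_le (B ^ D * prodMult B R D)]

theorem list_prod_mem_cls {P B R : ℕ} (l : List (ℕ → ℤ))
    (hl : ∀ u ∈ l, u ∈ cls P B R) : l.prod ∈ cls P (B ^ l.length) (prodMult B R l.length) := by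
  induction l with
  | nil => exact one_mem_cls P (by simp) (by simp [prodMult])
  | cons u l ih =>
    have := mul_mem_cls (hl u (by simp)) (ih fun v hv => hl v (by simp [hv]))
    rw [List.prod_cons, List.length_cons, prodMult, pow_succ']
    exact this

/-- The values of q are a combination of products of at most D of the sequences. Only the variables
that occur in q matter, which is what the induction over blocks needs. -/
theorem mvPolynomial_mem_cls {P B R D : ℕ} {σ : Type} (q : MvPolynomial σ ℤ) (x : σ → ℕ → ℤ)
    (hB : 1 ≤ B) (hD : q.totalDegree ≤ D) (hx : ∀ i ∈ q.vars, x i ∈ cls P B R) :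
    (fun n => MvPolynomial.eval (fun i => x i n) q) ∈ cls P (B ^ D) (prodMult B R D) := by
  have e : (fun n => MvPolynomial.eval (fun i => x i n) q) =
      ∑ m ∈ q.support, q.coeff m • (m.toMultiset.map x).prod := by
    ext n
    rw [MvPolynomial.eval_eq]
    simp only [Finset.sum_apply, Pi.smul_apply, smul_eq_mul]
    refine Finset.sum_congr rfl fun m _ => ?_
    congr 1
    classical
    rw [Finset.prod_multiset_map_count]
    simp [Finsupp.toFinset_toMultiset, Finset.prod_apply]
  rw [e]
  refine Submodule.sum_mem _ fun m hm => Submodule.smul_mem _ _ ?_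
  obtain ⟨l, hl⟩ := Quot.exists_rep (m.toMultiset)
  have hl' : (l : Multiset σ) = m.toMultiset := hl
  rw [← hl', Multiset.map_coe, Multiset.prod_coe]
  have hlen : (l.map x).length ≤ D := by
    have : (l.map x).length = m.degree := by
      rw [List.length_map, ← Multiset.coe_card, hl', Finsupp.card_toMultiset]; rfl
    rw [this]
    exact (MvPolynomial.le_totalDegree hm).trans hD
  refine cls_mono (Nat.pow_le_pow_right hB hlen) (prodMult_mono _ _ hlen)
    (list_prod_mem_cls _ fun u hu => ?_)
  obtain ⟨i, hi, rfl⟩ := List.mem_map.1 hu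
  refine hx i ((MvPolynomial.mem_vars_iff_mem_support i).2 ⟨m, hm, ?_⟩)
  rw [← Finsupp.mem_toMultiset, ← hl']
  exact hi

/-! ### Linear systems with inhomogeneity in the class -/

/-- A linear system `x(n+1) = A x(n) + q(n)`: the characteristic polynomial of `A`, applied to
the shift, turns `x` into a combination of shifts of `q`. -/
theorem aeval_charpoly_apply {ι : Type} [Fintype ι] [DecidableEq ι] (A : Matrix ι ι ℤ)
    (x q : ι → ℕ → ℤ) (h : ∀ i, shift (x i) = ∑ j, A i j • x j + q i) (i : ι) :
    aeval shift A.charpoly (x i) =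
      ∑ k, aeval shift ((Matrix.charmatrix A).adjugate i k) (q k) := by
  have h1 : ∀ k, ∑ j, aeval shift (Matrix.charmatrix A k j) (x j) = q k := by
    intro k
    have : ∀ j, aeval shift (Matrix.charmatrix A k j) (x j) =
        (if k = j then shift (x j) else 0) - A k j • x j := by
      intro j
      rw [Matrix.charmatrix_apply, map_sub, LinearMap.sub_apply, Matrix.diagonal_apply]
      congr 1
      · split_ifs <;> simp
      · simp
    simp only [this, Finset.sum_sub_distrib, Finset.sum_ite_eq, Finset.mem_univ, if_true, h k]
    abel
  -- With X read as the shift, the system says (X - A) x = q; multiplying by the adjugate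
  -- diagonalises the left side.
  have h2 := Matrix.adjugate_mul (Matrix.charmatrix A)
  calc aeval shift A.charpoly (x i)
      = ∑ j, aeval shift (((Matrix.charmatrix A).adjugate * Matrix.charmatrix A) i j) (x j) := by
        rw [h2]
        rw [Finset.sum_eq_single i]
        · simp [Matrix.charpoly]
        · intro j _ hj; simp [Matrix.one_apply_ne (Ne.symm hj)]
        · simp
    _ = ∑ j, ∑ k, aeval shift ((Matrix.charmatrix A).adjugate i k)
          (aeval shift (Matrix.charmatrix A k j) (x j)) := by
        refine Finset.sum_congr rfl fun j _ => ?_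
        rw [Matrix.mul_apply, map_sum, LinearMap.sum_apply]
        simp
    _ = _ := by
        rw [Finset.sum_comm]
        refine Finset.sum_congr rfl fun k _ => ?_
        rw [← map_sum, h1]

/-- For monic f divisibility can be tested over ℂ. There f is a product of at most n linear factors,
each dividing the expanded `rootProd`; the n-th power takes care of multiplicities. -/
theorem dvd_expand_rootProd_pow {f : ℤ[X]} (hf : f.Monic) {P B n : ℕ} (hn : f.natDegree ≤ n)
    (h : ∀ z : ℂ, aeval z f = 0 → ∃ b : ℕ, b ≤ B ∧ z ^ P = b) :
    f ∣ expand ℤ P (rootProd B ^ n) := by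
  have inj : Function.Injective (Int.castRingHom ℂ) := Int.cast_injective
  rw [← map_dvd_map _ inj hf, map_expand, Polynomial.map_pow, map_pow]
  have hs := IsAlgClosed.splits (f.map (Int.castRingHom ℂ))
  rw [hs.eq_prod_roots_of_monic (hf.map _)]
  have hc : Multiset.card (f.map (Int.castRingHom ℂ)).roots ≤ n :=
    (card_roots' _).trans (natDegree_map_le.trans hn)
  have hr : ∀ z ∈ (f.map (Int.castRingHom ℂ)).roots,
      (X - C z) ∣ expand ℂ P ((rootProd B).map (Int.castRingHom ℂ)) := by
    intro z hz
    have hz' := (mem_roots'.1 hz).2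
    obtain ⟨b, hb, hzb⟩ := h z (by
      rw [IsRoot, eval_map] at hz'
      rw [aeval_def]
      exact hz')
    rw [dvd_iff_isRoot, IsRoot, expand_eval, hzb, eval_map]
    obtain ⟨g, hg⟩ := X_sub_dvd_rootProd hb
    rw [hg, eval₂_mul]
    simp
  refine Dvd.dvd.trans ?_ (pow_dvd_pow _ hc)
  generalize (f.map (Int.castRingHom ℂ)).roots = s at hr
  induction s using Multiset.induction_on with
  | empty => simp
  | cons a s ih =>
    rw [Multiset.map_cons, Multiset.prod_cons, Multiset.card_cons, pow_succ']
    exact mul_dvd_mul (hr a (by simp)) (ih fun z hz => hr z (by simp [hz]))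

theorem mem_cls_of_linear_system {ι : Type} [Fintype ι] [DecidableEq ι] (A : Matrix ι ι ℤ)
    (x q : ι → ℕ → ℤ) (h : ∀ i, shift (x i) = ∑ j, A i j • x j + q i) {P B R n : ℕ}
    (hn : Fintype.card ι ≤ n)
    (hA : ∀ z : ℂ, aeval z A.charpoly = 0 → ∃ b : ℕ, b ≤ B ∧ z ^ P = b)
    (hq : ∀ i, q i ∈ cls P B R) (i : ι) : x i ∈ cls P B (R + n) := by
  have h1 : aeval shift A.charpoly (x i) ∈ cls P B R := by
    rw [aeval_charpoly_apply A x q h i]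
    exact Submodule.sum_mem _ fun k _ => aeval_apply_mem_cls _ (hq k)
  have h2 : A.charpoly ∣ expand ℤ P (rootProd B ^ n) := by
    refine dvd_expand_rootProd_pow A.charpoly_monic ?_ hA
    rw [Matrix.charpoly_natDegree_eq_dim]; exact hn
  rw [mem_cls, ← expand_aeval, ← Module.End.mul_apply, ← map_mul] at h1
  rw [mem_cls, ← expand_aeval]
  refine aeval_eq_zero_of_dvd ?_ h1
  rw [pow_add, map_mul]
  exact mul_dvd_mul dvd_rfl h2

/-! ### Eventual signs of annihilated sequences -/

theorem aeval_X_sub_C_apply (b : ℕ) (v : ℕ → ℤ) (n : ℕ) :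
    aeval shift (X - C (b : ℤ)) v n = v (n + 1) - b * v n := by
  simp [shift_apply]

/-- Each factor E - b looks one index further ahead and multiplies the bound by at most B + 1. -/
theorem abs_listProd_apply_le {B N M : ℕ} (S : List ℕ) (hS : ∀ b ∈ S, b ≤ B) (v : ℕ → ℤ)
    (hv : ∀ n < N, |v n| ≤ M) (n : ℕ) (hn : n + S.length < N) :
    |aeval shift (listProd S) v n| ≤ M * (B + 1) ^ S.length := by
  induction S generalizing n with
  | nil => simpa [listProd] using hv n (by simpa using hn)
  | cons b S ih =>
    simp only [List.length_cons] at hn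
    have i1 := ih (fun c hc => hS c (by simp [hc])) (n + 1) (by omega)
    have i0 := ih (fun c hc => hS c (by simp [hc])) n (by omega)
    rw [listProd_cons, map_mul, Module.End.mul_apply, aeval_X_sub_C_apply]
    have hb : (b : ℤ) ≤ B := by exact_mod_cast hS b (by simp)
    calc _ ≤ |aeval shift (listProd S) v (n + 1)| + |(b : ℤ) * aeval shift (listProd S) v n| :=
          abs_sub _ _
      _ ≤ M * (B + 1) ^ S.length + B * (M * (B + 1) ^ S.length) := by
          rw [abs_mul, Nat.abs_cast]; gcongr
      _ = _ := by rw [List.length_cons, pow_succ]; ring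

/-- Peel off one root b: w = (E - b) v has one root fewer, and solving v(n+1) = b v(n) + w(n) costs
one more factor n + 1. The rate β may lie below B, which later separates lower-order terms from the
dominant one. -/
theorem abs_le_of_listProd_apply_eq_zero {B K M : ℕ} {β : ℝ} (hβ : 1 / 2 ≤ β) (S : List ℕ)
    (hS : ∀ b ∈ S, b ≤ B ∧ (b : ℝ) ≤ β) (v : ℕ → ℤ) (h0 : aeval shift (listProd S) v = 0)
    (hK : S.length ≤ K) (hv : ∀ n < K, |v n| ≤ M) (n : ℕ) :
    |(v n : ℝ)| ≤ M * (2 * (B + 1)) ^ K * (n + 1) ^ K * β ^ n := by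
  have hβ0 : 0 < β := by linarith
  have main : ∀ (M : ℝ), (∀ n < S.length, |(v n : ℝ)| ≤ M) → 0 ≤ M →
      |(v n : ℝ)| ≤ M * (2 * (B + 1)) ^ S.length * (n + 1) ^ S.length * β ^ n := by
    clear hv hK
    induction S generalizing v n with
    | nil =>
      intro M _ hM
      have : v = 0 := by simpa [listProd] using h0
      rw [this]; simp; positivity
    | cons b S ih =>
      intro M hv hM
      have hb := hS b (by simp)
      have hbB : (b : ℝ) ≤ B := by exact_mod_cast hb.1
      set w := aeval shift (X - C (b : ℤ)) v with hw
      have w0 : aeval shift (listProd S) w = 0 := by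
        rw [listProd_cons, mul_comm, map_mul, Module.End.mul_apply] at h0; exact h0
      have e : ∀ m, (v (m + 1) : ℝ) = b * v m + w m := by
        intro m; rw [hw, aeval_X_sub_C_apply]; push_cast; ring
      have hwb : ∀ m < S.length, |(w m : ℝ)| ≤ M * (B + 1) := by
        intro m hm
        have : (w m : ℝ) = v (m + 1) - b * v m := by rw [e]; ring
        rw [this]
        calc _ ≤ |(v (m + 1) : ℝ)| + |(b : ℝ) * v m| := abs_sub _ _
          _ ≤ M + B * M := by
            rw [abs_mul, Nat.abs_cast]
            exact add_le_add (hv _ (by simp; omega))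
              (mul_le_mul hbB (hv _ (by simp; omega)) (abs_nonneg _) (by positivity))
          _ = _ := by ring
      have ihw := fun m => ih (fun c hc => hS c (by simp [hc])) w w0 m (M * (B + 1)) hwb
        (by positivity)
      clear ih
      induction n with
      | zero =>
        have := hv 0 (by simp)
        simp only [Nat.cast_zero, zero_add, one_pow, pow_zero, mul_one]
        refine this.trans (le_mul_of_one_le_right hM (one_le_pow₀ ?_))
        linarith [(Nat.cast_nonneg B : (0 : ℝ) ≤ B)]
      | succ n ihn =>
        rw [e]
        have hA : (0 : ℝ) ≤ M * (2 * (B + 1)) ^ (S.length + 1) := by positivity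
        have i2 := ihw n
        simp only [List.length_cons] at ihn ⊢
        set A := M * (2 * ((B : ℝ) + 1)) ^ (S.length + 1) with hAdef
        -- The factor 2 in 2 (B + 1) leaves a spare 1/2 here, which is at most β.
        have i3 : |(w n : ℝ)| ≤ A * (n + 1) ^ S.length * (β * β ^ n) := by
          have : M * (B + 1) * (2 * ((B : ℝ) + 1)) ^ S.length = A * (1 / 2) := by
            rw [hAdef, pow_succ]; ring
          rw [this] at i2
          calc _ ≤ _ := i2
            _ = A * (n + 1) ^ S.length * (1 / 2 * β ^ n) := by ring
            _ ≤ _ := by gcongr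
        have i4 : ((n : ℝ) + 1) ^ (S.length + 1) + (n + 1) ^ S.length ≤
            (n + 1 + 1) ^ (S.length + 1) := by
          calc _ = ((n : ℝ) + 1) ^ S.length * (n + 1 + 1) := by ring
            _ ≤ (n + 1 + 1) ^ S.length * (n + 1 + 1) := by gcongr; linarith
            _ = _ := by ring
        calc |(b : ℝ) * v n + w n| ≤ |(b : ℝ) * v n| + |(w n : ℝ)| := abs_add_le _ _
          _ ≤ β * (A * (n + 1) ^ (S.length + 1) * β ^ n) +
              A * (n + 1) ^ S.length * (β * β ^ n) := by
            rw [abs_mul, Nat.abs_cast]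
            exact add_le_add (mul_le_mul hb.2 ihn (abs_nonneg _) hβ0.le) i3
          _ = A * ((n + 1) ^ (S.length + 1) + (n + 1) ^ S.length) * (β * β ^ n) := by ring
          _ ≤ A * (n + 1 + 1) ^ (S.length + 1) * (β * β ^ n) := by gcongr
          _ = _ := by push_cast; ring
  refine (main M (fun n hn => by exact_mod_cast hv n (by omega)) (by positivity)).trans ?_
  have h1 : (1 : ℝ) ≤ 2 * (B + 1) := by linarith [(Nat.cast_nonneg B : (0 : ℝ) ≤ B)]
  have h2 : (1 : ℝ) ≤ n + 1 := by linarith [(Nat.cast_nonneg n : (0 : ℝ) ≤ n)]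
  gcongr

/-- (b - 1/2)^n ≤ b^n exp(-n/(2b)), and the exponential series term of order k + 1 beats (n + 1)^k
as soon as n exceeds the stated constant, which is linear in M. -/
theorem mul_pow_mul_pow_le_half {b n k M : ℕ} (hb : 1 ≤ b)
    (hn : 2 * M * 2 ^ k * (k + 1).factorial * (2 * b) ^ (k + 1) ≤ n) (hn1 : 1 ≤ n) :
    (M : ℝ) * (n + 1) ^ k * ((b : ℝ) - 1 / 2) ^ n ≤ (b : ℝ) ^ n / 2 := by
  have hb' : (1 : ℝ) ≤ b := by exact_mod_cast hb
  have hn' : (1 : ℝ) ≤ n := by exact_mod_cast hn1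
  have e1 : (b : ℝ) - 1 / 2 ≤ b * Real.exp (-(1 / (2 * b))) := by
    have := Real.add_one_le_exp (-(1 / (2 * (b : ℝ))))
    calc (b : ℝ) - 1 / 2 = b * (-(1 / (2 * b)) + 1) := by field_simp; ring
      _ ≤ _ := by gcongr
  have e2 : ((b : ℝ) - 1 / 2) ^ n ≤ b ^ n * Real.exp (-(n / (2 * b))) := by
    calc _ ≤ (b * Real.exp (-(1 / (2 * b)))) ^ n := pow_le_pow_left₀ (by linarith) e1 n
      _ = _ := by rw [mul_pow, ← Real.exp_nat_mul]; congr 2; ring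
  have e3 := Real.pow_div_factorial_le_exp ((n : ℝ) / (2 * b)) (by positivity) (k + 1)
  have e4 : 2 * M * ((n : ℝ) + 1) ^ k ≤ Real.exp (n / (2 * b)) := by
    refine le_trans ?_ e3
    rw [le_div_iff₀ (by positivity), div_pow, le_div_iff₀ (by positivity)]
    have h1 : (2 * M * 2 ^ k * (k + 1).factorial * (2 * b) ^ (k + 1) : ℝ) ≤ n := by
      exact_mod_cast hn
    calc _ ≤ 2 * M * ((n : ℝ) + n) ^ k * ((k + 1).factorial) * (2 * b) ^ (k + 1) := by gcongr
      _ = (2 * M * 2 ^ k * (k + 1).factorial * (2 * b) ^ (k + 1)) * n ^ k := by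
        rw [← two_mul, mul_pow]; ring
      _ ≤ n * n ^ k := by gcongr
      _ = _ := by ring
  have e5 : Real.exp (-(n / (2 * b))) * Real.exp ((n : ℝ) / (2 * b)) = 1 := by
    rw [← Real.exp_add]; simp
  have hbn : (0 : ℝ) ≤ b ^ n := by positivity
  have hex := (Real.exp_pos (-((n : ℝ) / (2 * b)))).le
  calc _ ≤ (M : ℝ) * (n + 1) ^ k * (b ^ n * Real.exp (-(n / (2 * b)))) := by gcongr
    _ = (b ^ n / 2) * ((2 * M * ((n : ℝ) + 1) ^ k) * Real.exp (-(n / (2 * b)))) := by ring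
    _ ≤ (b ^ n / 2) * (Real.exp (n / (2 * b)) * Real.exp (-(n / (2 * b)))) := by gcongr
    _ = _ := by rw [mul_comm (Real.exp _), e5, mul_one]

/-- If `(E - b) w` grows at least like `b ^ n / G` after time `τ` and `w` is not too negative at
time `τ`, then `w` grows at least like `b ^ n / (G b)` after a polynomially later time. -/
theorem pow_le_of_pow_le_aeval {b G M k τ : ℕ} (hb : 1 ≤ b) (w : ℕ → ℤ)
    (h : ∀ n, τ ≤ n → (b : ℤ) ^ n ≤ G * aeval shift (X - C (b : ℤ)) w n)
    (hw : |w τ| ≤ M * (τ + 1) ^ k * (b : ℤ) ^ τ) (n : ℕ)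
    (hn : τ + 1 + G * b * M * (τ + 1) ^ k ≤ n) : (b : ℤ) ^ n ≤ (G * b : ℕ) * w n := by
  -- The quotient G b w(n) / b^n increases by at least 1 in each step from time τ on, and starts no
  -- lower than -G b M (τ + 1)^k.
  have key : ∀ m, (b : ℤ) ^ (τ + m) * (m - G * b * M * (τ + 1) ^ k) ≤ (G * b : ℕ) * w (τ + m) := by
    intro m
    induction m with
    | zero =>
      have := (abs_le.1 hw).1
      have hG : (0 : ℤ) ≤ (G * b : ℕ) := by positivity
      have := mul_le_mul_of_nonneg_left this hG
      push_cast at this ⊢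
      simp only [add_zero]
      linarith
    | succ m ih =>
      have h1 := h (τ + m) (by omega)
      rw [aeval_X_sub_C_apply] at h1
      have hb0 : (0 : ℤ) ≤ b := by positivity
      have h2 := mul_le_mul_of_nonneg_left ih hb0
      have h3 := mul_le_mul_of_nonneg_left h1 hb0
      push_cast at *
      rw [← add_assoc, pow_succ]
      linarith
  obtain ⟨m, rfl⟩ : ∃ m, n = τ + m := ⟨n - τ, by omega⟩
  refine le_trans ?_ (key m)
  have : (1 : ℤ) ≤ m - G * b * M * (τ + 1) ^ k := by
    have : 1 + G * b * M * (τ + 1) ^ k ≤ m := by omega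
    have : ((1 + G * b * M * (τ + 1) ^ k : ℕ) : ℤ) ≤ m := by exact_mod_cast this
    push_cast at this; linarith
  exact le_mul_of_one_le_right (by positivity) this

theorem aeval_geom (f : ℤ[X]) (b : ℤ) : aeval shift f (fun n => b ^ n) = fun n => f.eval b * b ^ n := by
  induction f using Polynomial.induction_on' with
  | add p q hp hq => rw [map_add, LinearMap.add_apply, hp, hq]; ext n; simp [add_mul]
  | monomial m a =>
    ext n
    simp [aeval_monomial, shift_pow_apply, pow_add]
    ring

/-- Undoes the j factors E - b one at a time with `pow_le_of_pow_le_aeval`. Each round costs a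
factor b in G and turns a threshold Z^e into Z^((e+1)(k+1)+1). The base Z stays fixed because it
absorbs all the constants, so the threshold remains polynomial in Z. -/
theorem lift_threshold {b Z k : ℕ} (hb : 1 ≤ b) (hZ : 2 ≤ Z) (v : ℕ → ℤ) (j : ℕ) :
    ∀ (G e M : ℕ), G * b ^ j * M ≤ Z →
    (∀ i ≤ j, ∀ n, |aeval shift ((X - C (b : ℤ)) ^ i) v n| ≤ M * (n + 1) ^ k * (b : ℤ) ^ n) →
    (∀ n, Z ^ e ≤ n + 1 → (b : ℤ) ^ n ≤ G * aeval shift ((X - C (b : ℤ)) ^ j) v n) →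
    ∀ n, Z ^ ((e + 1) * (k + 3) ^ j) ≤ n + 1 → 0 < v n := by
  induction j with
  | zero =>
    intro G e M _ _ h n hn
    have h1 := h n ((Nat.pow_le_pow_right (by omega) (by simp)).trans hn)
    have : (0 : ℤ) < b ^ n := by positivity
    simp only [pow_zero, map_one, Module.End.one_apply] at h1
    exact pos_of_mul_pos_right (this.trans_le h1) (by positivity)
  | succ j ih =>
    intro G e M hG hM h n hn
    refine ih (G * b) ((e + 1) * (k + 1) + 1) M ?_ (fun i hi => hM i (by omega)) ?_ n
      (le_trans (Nat.pow_le_pow_right (by omega) ?_) hn)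
    · calc _ = G * b ^ (j + 1) * M := by ring
        _ ≤ Z := hG
    · intro m hm
      have hZe : 1 ≤ Z ^ e := Nat.one_le_pow _ _ (by omega)
      -- Thresholds are compared with n + 1, so that τ + 1 is exactly Z^e.
      refine pow_le_of_pow_le_aeval (τ := Z ^ e - 1) (M := M) (k := k) hb _ ?_ ?_ m ?_
      · intro n hn
        have := h n (by omega)
        rwa [pow_succ', map_mul, Module.End.mul_apply] at this
      · exact hM j (by omega) _
      · rw [Nat.sub_add_cancel hZe]
        have h1 : G * b * M ≤ Z := by
          refine le_trans ?_ hG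
          gcongr
          calc b = b ^ 1 := (pow_one b).symm
            _ ≤ _ := Nat.pow_le_pow_right hb (by omega)
        have h2 : Z ^ e + 1 ≤ Z ^ ((e + 1) * (k + 1)) := by
          calc Z ^ e + 1 ≤ Z ^ e * 2 := by omega
            _ ≤ Z ^ e * Z := by gcongr
            _ = Z ^ (e + 1) := (pow_succ _ _).symm
            _ ≤ _ := Nat.pow_le_pow_right (by omega) (Nat.le_mul_of_pos_right _ (by omega))
        have h3 : G * b * M * (Z ^ e) ^ k ≤ Z ^ ((e + 1) * (k + 1)) := by
          calc _ ≤ Z * (Z ^ e) ^ k := by gcongr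
            _ = Z ^ (e * k + 1) := by rw [← pow_mul, ← pow_succ']
            _ ≤ _ := Nat.pow_le_pow_right (by omega) (by nlinarith)
        have h4 : Z ^ ((e + 1) * (k + 1)) * 2 ≤ Z ^ ((e + 1) * (k + 1) + 1) := by
          rw [pow_succ]; gcongr
        omega
    · calc ((e + 1) * (k + 1) + 1 + 1) * (k + 3) ^ j ≤ ((e + 1) * (k + 3)) * (k + 3) ^ j := by
            gcongr; nlinarith
        _ = _ := by ring

/-- A constant for the time after which sequences of `cls 1 B R` have constant signs, where
`k = (B + 1) * R`. -/
def signConst (B k : ℕ) : ℕ :=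
  k + 2 + 2 * (2 * (B + 1) ^ (2 * k) * (2 * (B + 1)) ^ k) * 2 ^ k * (k + 1).factorial *
    (2 * B) ^ (k + 1) + 2 * (B + 1) ^ k * B ^ k * ((B + 1) ^ k * (2 * (B + 1)) ^ k)

theorem add_two_le_signConst (B k : ℕ) : k + 2 ≤ signConst B k := by
  rw [signConst, add_assoc (k + 2)]
  exact Nat.le_add_right _ _

/-- The geometric sequence s b^n is the dominant part of v after the lower roots S and j copies of b
are removed. Put w_i = (E - b)^i v. Up to the factor D = ∏ (b - c), w_j equals s b^n plus a term
with roots below b, so w_j is eventually at least b^n / (2D). `lift_threshold` carries this from w_j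
back to v. -/
theorem pos_of_leading_pos {B k M b j : ℕ} (hb : 1 ≤ b) (hbB : b ≤ B) (hM : 1 ≤ M) (S : List ℕ)
    (hS : ∀ c ∈ S, c < b) (hk : S.length + j + 1 ≤ k) (v : ℕ → ℤ) (hv : ∀ n < k, |v n| ≤ M)
    (s : ℤ) (hs : 0 < s)
    (h : ∀ n, aeval shift (listProd S * (X - C (b : ℤ)) ^ j) v n = s * b ^ n) (n : ℕ)
    (hn : (signConst B k * M) ^ (2 * (k + 3) ^ k) ≤ n) : 0 < v n := by
  have hb' : (1 : ℝ) ≤ b := by exact_mod_cast hb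
  have hbz : (1 : ℤ) ≤ b := by exact_mod_cast hb
  have hpow : ∀ i, (X - C (b : ℤ)) ^ i = listProd (List.replicate i b) := by
    intro i; simp [listProd]
  have hD0 : 0 < (listProd S).eval (b : ℤ) ∧ (listProd S).eval (b : ℤ) ≤ (B + 1) ^ k := by
    have hl : S.length ≤ k := by omega
    have : 0 < (listProd S).eval (b : ℤ) ∧ (listProd S).eval (b : ℤ) ≤ (B + 1) ^ S.length := by
      clear h hk hl
      induction S with
      | nil => simp [listProd]
      | cons c S ih =>
        have hc : (c : ℤ) < b := by exact_mod_cast hS c (by simp)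
        have hbB' : (b : ℤ) ≤ B := by exact_mod_cast hbB
        have := ih fun c hc => hS c (by simp [hc])
        rw [listProd_cons, eval_mul, eval_sub, eval_X, eval_C, List.length_cons, pow_succ']
        refine ⟨mul_pos (by linarith) this.1, ?_⟩
        exact mul_le_mul (by linarith [(Nat.cast_nonneg c : (0 : ℤ) ≤ c)]) this.2 this.1.le
          (by positivity)
    exact ⟨this.1, this.2.trans (pow_le_pow_right₀ (by linarith) hl)⟩
  -- D is the factor by which the operator `listProd S` scales the sequence b^n.
  obtain ⟨D, hD⟩ := Int.eq_ofNat_of_zero_le hD0.1.le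
  rw [hD] at hD0
  have hD1 : 1 ≤ D := by exact_mod_cast hD0.1
  have hD2 : D ≤ (B + 1) ^ k := by exact_mod_cast hD0.2
  set w : ℕ → ℕ → ℤ := fun i => aeval shift ((X - C (b : ℤ)) ^ i) v with hw
  have hwb : ∀ i, ∀ n, n + i < k → |w i n| ≤ M * (B + 1) ^ k := by
    intro i n hn
    have := abs_listProd_apply_le (B := B) (N := k) (M := M) (List.replicate i b)
      (fun c hc => by rw [List.eq_of_mem_replicate hc]; exact hbB) v hv n (by simpa using hn)
    rw [← hpow, List.length_replicate] at this
    exact this.trans (by gcongr <;> omega)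
  -- One factor E - b beyond the given j kills s b^n.
  have hkill : ∀ i ≤ j, aeval shift (listProd (S ++ List.replicate (j - i + 1) b)) (w i) = 0 := by
    intro i hi
    have : listProd (S ++ List.replicate (j - i + 1) b) * (X - C (b : ℤ)) ^ i =
        (X - C (b : ℤ)) * (listProd S * (X - C (b : ℤ)) ^ j) := by
      have e : (X - C (b : ℤ)) ^ j = (X - C (b : ℤ)) ^ (j - i) * (X - C (b : ℤ)) ^ i := by
        rw [← pow_add, Nat.sub_add_cancel hi]
      rw [e]
      simp [listProd]; ring
    rw [hw]
    simp only
    rw [← Module.End.mul_apply, ← map_mul, this, map_mul, Module.End.mul_apply]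
    ext m
    rw [aeval_X_sub_C_apply, h, h]
    simp only [Pi.zero_apply]; ring
  have hgv : ∀ i ≤ j, ∀ n, |w i n| ≤ ((M * ((B + 1) ^ k * (2 * (B + 1)) ^ k) : ℕ) : ℤ) *
      (n + 1) ^ k * (b : ℤ) ^ n := by
    intro i hi n
    have h1 := abs_le_of_listProd_apply_eq_zero (β := b) (B := B) (K := k - i)
      (M := M * (B + 1) ^ k) (by linarith) _ (fun c hc => ?_) (w i) (hkill i hi) (by simp; omega)
      (fun n hn => by push_cast; exact hwb i n (by omega)) n
    · have h2 : ((M * (B + 1) ^ k : ℕ) : ℝ) * (2 * (B + 1)) ^ (k - i) * (n + 1) ^ (k - i) * b ^ n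
          ≤ ((M * ((B + 1) ^ k * (2 * (B + 1)) ^ k) : ℕ) : ℝ) * (n + 1) ^ k * b ^ n := by
        push_cast
        rw [← mul_assoc (M : ℝ)]
        gcongr
        · linarith [(Nat.cast_nonneg B : (0 : ℝ) ≤ B)]
        · omega
        · linarith [(Nat.cast_nonneg n : (0 : ℝ) ≤ n)]
        · omega
      exact_mod_cast h1.trans h2
    · have hcb : c ≤ b := by
        rcases List.mem_append.1 hc with h | h
        · exact (hS c h).le
        · exact (List.eq_of_mem_replicate h).le
      exact ⟨hcb.trans hbB, by exact_mod_cast hcb⟩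
  -- the leading part of `w j`
  set t : ℕ → ℤ := (D : ℤ) • w j - s • (fun n => (b : ℤ) ^ n) with ht
  have ht0 : aeval shift (listProd S) t = 0 := by
    rw [ht, map_sub, map_zsmul, map_zsmul, aeval_geom, hD, hw, ← Module.End.mul_apply, ← map_mul]
    ext m
    simp only [Pi.sub_apply, Pi.smul_apply, h, smul_eq_mul, Pi.zero_apply]
    ring
  have hbB' : (b : ℤ) ≤ B + 1 := by have : (b : ℤ) ≤ B := by exact_mod_cast hbB
                                    linarith
  have hB1 : (1 : ℤ) ≤ B + 1 := by linarith
  have hsM : s ≤ M * (B + 1) ^ k := by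
    have h1 := abs_listProd_apply_le (B := B) (N := k) (M := M) (S ++ List.replicate j b)
      (fun c hc => ?_) v hv 0 (by simp; omega)
    · have h2 : listProd (S ++ List.replicate j b) = listProd S * (X - C (b : ℤ)) ^ j := by
        simp [listProd]
      rw [h2, h, pow_zero, mul_one, abs_of_pos hs] at h1
      refine h1.trans (mul_le_mul_of_nonneg_left (pow_le_pow_right₀ hB1 ?_) (by positivity))
      simp; omega
    · rcases List.mem_append.1 hc with h | h
      · exact (hS c h).le.trans hbB
      · rw [List.eq_of_mem_replicate h]; exact hbB
  have htM : ∀ n < S.length, |t n| ≤ ((2 * M * (B + 1) ^ (2 * k) : ℕ) : ℤ) := by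
    intro n hn
    have h1 := hwb j n (by omega)
    have hDz : (D : ℤ) ≤ (B + 1) ^ k := by exact_mod_cast hD2
    have h3 : (b : ℤ) ^ n ≤ (B + 1) ^ k :=
      (pow_le_pow_left₀ (by positivity) hbB' n).trans (pow_le_pow_right₀ hB1 (by omega))
    calc |t n| ≤ |(D : ℤ) * w j n| + |s * (b : ℤ) ^ n| := abs_sub _ _
      _ ≤ (B + 1) ^ k * (M * (B + 1) ^ k) + M * (B + 1) ^ k * (B + 1) ^ k := by
        rw [abs_mul, abs_mul, Nat.abs_cast, abs_of_pos hs,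
          abs_of_nonneg (a := (b : ℤ) ^ n) (by positivity)]
        gcongr
      _ = _ := by push_cast; rw [two_mul k, pow_add]; ring
  -- Roots below b are at most b - 1, hence below b - 1/2. This rate is still at least 1/2, as the
  -- growth lemma requires, even for b = 1.
  have htg : ∀ n, |(t n : ℝ)| ≤ ((2 * M * (B + 1) ^ (2 * k) * (2 * (B + 1)) ^ k : ℕ) : ℝ) *
      (n + 1) ^ k * ((b : ℝ) - 1 / 2) ^ n := by
    intro n
    refine (abs_le_of_listProd_apply_eq_zero (β := (b : ℝ) - 1 / 2) (B := B) (K := S.length)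
      (by linarith) S (fun c hc => ⟨(hS c hc).le.trans hbB, ?_⟩) t ht0 le_rfl htM n).trans ?_
    · have : ((c + 1 : ℕ) : ℝ) ≤ b := by exact_mod_cast hS c hc
      push_cast at this; linarith
    · have : (0 : ℝ) ≤ (b : ℝ) - 1 / 2 := by linarith
      push_cast
      gcongr
      · linarith [(Nat.cast_nonneg B : (0 : ℝ) ≤ B)]
      · omega
      · linarith [(Nat.cast_nonneg n : (0 : ℝ) ≤ n)]
      · omega
  set Z := signConst B k * M with hZ
  -- Each summand of `signConst` has its purpose: k + 2 for the small offsets, the second for the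
  -- dominance of b^n over (b - 1/2)^n, the third for the hypothesis on G in `lift_threshold`.
  have hZ1 : (k + 2) * M ≤ Z := by
    exact Nat.mul_le_mul_right M (add_two_le_signConst B k)
  have hZ2 : 2 * (2 * (B + 1) ^ (2 * k) * (2 * (B + 1)) ^ k) * 2 ^ k * (k + 1).factorial *
      (2 * B) ^ (k + 1) * M + 2 * M ≤ Z := by
    rw [hZ, ← add_mul]
    refine Nat.mul_le_mul_right M ?_
    rw [signConst]
    generalize 2 * (2 * (B + 1) ^ (2 * k) * (2 * (B + 1)) ^ k) * 2 ^ k * (k + 1).factorial *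
      (2 * B) ^ (k + 1) = x
    generalize 2 * (B + 1) ^ k * B ^ k * ((B + 1) ^ k * (2 * (B + 1)) ^ k) = y
    omega
  have hZ3 : 2 * (B + 1) ^ k * B ^ k * ((B + 1) ^ k * (2 * (B + 1)) ^ k) * M ≤ Z := by
    rw [hZ, signConst]
    exact Nat.mul_le_mul_right M (Nat.le_add_left _ _)
  have hlead : ∀ n, Z ^ 1 ≤ n + 1 → (b : ℤ) ^ n ≤ (2 * D : ℕ) * w j n := by
    intro n hn
    rw [pow_one] at hn
    have h1 := mul_pow_mul_pow_le_half (n := n) (k := k)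
      (M := 2 * M * (B + 1) ^ (2 * k) * (2 * (B + 1)) ^ k) hb ?_ (by nlinarith)
    · have h2 := (abs_le.1 ((htg n).trans h1)).1
      have h3 : (t n : ℝ) = D * w j n - s * b ^ n := by rw [ht]; simp
      -- Integrality of s enters here: without a lower bound on the leading coefficient no uniform
      -- threshold would exist.
      have h4 : (1 : ℝ) ≤ s := by exact_mod_cast hs
      have h5 : (b : ℝ) ^ n ≤ s * b ^ n := le_mul_of_one_le_left (by positivity) h4
      have : (b : ℝ) ^ n ≤ (2 * D : ℕ) * w j n := by push_cast; linarith
      exact_mod_cast this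
    · have : 2 * (2 * M * (B + 1) ^ (2 * k) * (2 * (B + 1)) ^ k) * 2 ^ k * (k + 1).factorial *
          (2 * b) ^ (k + 1) ≤ 2 * (2 * (B + 1) ^ (2 * k) * (2 * (B + 1)) ^ k) * 2 ^ k *
          (k + 1).factorial * (2 * B) ^ (k + 1) * M := by
        calc _ ≤ 2 * (2 * M * (B + 1) ^ (2 * k) * (2 * (B + 1)) ^ k) * 2 ^ k * (k + 1).factorial *
              (2 * B) ^ (k + 1) := by gcongr
          _ = _ := by ring
      omega
  have hZ4 : 2 ≤ Z := by nlinarith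
  refine lift_threshold hb hZ4 v j (2 * D) 1 (M * ((B + 1) ^ k * (2 * (B + 1)) ^ k)) ?_ hgv hlead n
    (le_trans (Nat.pow_le_pow_right (by omega) ?_) (hn.trans (Nat.le_succ n)))
  · refine le_trans ?_ hZ3
    calc 2 * D * b ^ j * (M * ((B + 1) ^ k * (2 * (B + 1)) ^ k))
        ≤ 2 * (B + 1) ^ k * B ^ k * (M * ((B + 1) ^ k * (2 * (B + 1)) ^ k)) := by
          have : b ^ j ≤ B ^ k := (Nat.pow_le_pow_left hbB j).trans
            (Nat.pow_le_pow_right (by omega) (by omega))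
          gcongr
      _ = _ := by ring
  · have : (k + 3) ^ j ≤ (k + 3) ^ k := Nat.pow_le_pow_right (by omega) (by omega)
    omega

/-- The exponent for the time after which sequences of `cls 1 B R` have constant signs. -/
def signExp (k : ℕ) : ℕ := 2 * (k + 3) ^ k

theorem sign_constant_of_leading {B k M b j : ℕ} (hbB : b ≤ B) (hM : 1 ≤ M) (S : List ℕ)
    (hS : ∀ c ∈ S, c < b) (hk : S.length + j + 1 ≤ k) (v : ℕ → ℤ) (hv : ∀ n < k, |v n| ≤ M)
    (s : ℤ) (h : ∀ n, aeval shift (listProd S * (X - C (b : ℤ)) ^ j) v n = s * b ^ n)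
    (hs : s ≠ 0) :
    (∀ n, (signConst B k * M) ^ signExp k ≤ n → 0 < v n) ∨
    (∀ n, (signConst B k * M) ^ signExp k ≤ n → v n ≤ 0) := by
  -- For b = 0 there are no lower roots, and v vanishes after index j; this falls under the
  -- alternative v n ≤ 0.
  rcases Nat.eq_zero_or_pos b with rfl | hb
  · right
    intro n hn
    have hS0 : S = [] := List.eq_nil_iff_forall_not_mem.2 fun c hc => by simpa using hS c hc
    subst hS0
    have hkn : k + 2 ≤ n := by
      refine le_trans ?_ hn
      have h2 := add_two_le_signConst B k
      calc k + 2 ≤ signConst B k * M := by nlinarith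
        _ = (signConst B k * M) ^ 1 := (pow_one _).symm
        _ ≤ _ := by
          refine Nat.pow_le_pow_right ?_ ?_
          · nlinarith
          · rw [signExp]; nlinarith [Nat.one_le_pow k (k + 3) (by omega)]
    obtain ⟨m, rfl⟩ : ∃ m, n = (m + 1) + j := ⟨n - j - 1, by simp at hk; omega⟩
    have := h (m + 1)
    simp only [listProd, List.map_nil, List.prod_nil, one_mul, Nat.cast_zero, C_0, sub_zero,
      map_pow, aeval_X, shift_pow_apply, ne_eq, Nat.add_eq_zero_iff, one_ne_zero, and_false,
      not_false_eq_true, zero_pow, mul_zero] at this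
    exact this.le
  · rcases lt_or_gt_of_ne hs with hs | hs
    · right
      intro n hn
      have := pos_of_leading_pos hb hbB hM S hS hk (-v) (fun n hn => by simpa using hv n hn) (-s)
        (by linarith) (fun n => by rw [map_neg, Pi.neg_apply, h]; ring) n hn
      simp only [Pi.neg_apply] at this
      linarith
    · left
      exact pos_of_leading_pos hb hbB hM S hS hk v hv s hs h

/-- Roots are removed from the largest downwards, one copy at a time, until the remaining operator
no longer kills v. What it leaves is a nonzero geometric sequence, the dominant term. -/
theorem sign_constant_of_mem_cls {B R M : ℕ} (hM : 1 ≤ M) {v : ℕ → ℤ}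
    (h0 : aeval shift (rootProd B ^ R) v = 0) (hv : ∀ n < (B + 1) * R, |v n| ≤ M) :
    (∀ n, (signConst B ((B + 1) * R) * M) ^ signExp ((B + 1) * R) ≤ n → 0 < v n) ∨
    (∀ n, (signConst B ((B + 1) * R) * M) ^ signExp ((B + 1) * R) ≤ n → v n ≤ 0) := by
  -- `S b` lists the roots 0, ..., b - 1, each R times.
  set S : ℕ → List ℕ := fun b => ((List.range b).map fun c => List.replicate R c).flatten with hS
  have hSs : ∀ b, S (b + 1) = S b ++ List.replicate R b := by
    intro b; simp [hS, List.range_succ]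
  have hSl : ∀ b, (S b).length = b * R := by
    intro b
    induction b with
    | zero => simp [hS]
    | succ b ih => rw [hSs, List.length_append, ih, List.length_replicate]; ring
  have hSm : ∀ b, ∀ c ∈ S b, c < b := by
    intro b c hc
    simp only [hS, List.mem_flatten, List.mem_map, List.mem_range] at hc
    obtain ⟨l, ⟨a, ha, rfl⟩, hc⟩ := hc
    rwa [List.eq_of_mem_replicate hc]
  have hSp : ∀ b, listProd (S (b + 1)) = listProd (S b) * (X - C (b : ℤ)) ^ R := by
    intro b; rw [hSs]; simp [listProd]
  have hlast : rootProd B ^ R = listProd (S (B + 1)) := by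
    rw [rootProd]
    generalize B + 1 = b
    induction b with
    | zero => simp [hS, listProd]
    | succ b ih => rw [Finset.prod_range_succ, mul_pow, ih, hSp]
  have main : ∀ b ≤ B + 1, aeval shift (listProd (S b)) v = 0 →
      (∀ n, (signConst B ((B + 1) * R) * M) ^ signExp ((B + 1) * R) ≤ n → 0 < v n) ∨
      (∀ n, (signConst B ((B + 1) * R) * M) ^ signExp ((B + 1) * R) ≤ n → v n ≤ 0) := by
    intro b
    induction b with
    | zero =>
      intro _ h
      have : v = 0 := by simpa [hS, listProd] using h
      right; intro n _; rw [this]; simp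
    | succ b ih =>
      intro hb h
      rw [hSp] at h
      have step : ∀ j ≤ R, aeval shift (listProd (S b) * (X - C (b : ℤ)) ^ j) v = 0 →
          (∀ n, (signConst B ((B + 1) * R) * M) ^ signExp ((B + 1) * R) ≤ n → 0 < v n) ∨
          (∀ n, (signConst B ((B + 1) * R) * M) ^ signExp ((B + 1) * R) ≤ n → v n ≤ 0) := by
        intro j
        induction j with
        | zero => intro _ h; exact ih (by omega) (by simpa using h)
        | succ j ihj =>
          intro hj h
          set s := aeval shift (listProd (S b) * (X - C (b : ℤ)) ^ j) v with hs
          have h1 : ∀ n, s n = s 0 * b ^ n := by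
            intro n
            have e : listProd (S b) * (X - C (b : ℤ)) ^ (j + 1) =
                (X - C (b : ℤ)) * (listProd (S b) * (X - C (b : ℤ)) ^ j) := by ring
            rw [e, map_mul, Module.End.mul_apply, ← hs] at h
            induction n with
            | zero => simp
            | succ n ihn =>
              have := congrFun h n
              rw [aeval_X_sub_C_apply, ihn] at this
              simp only [Pi.zero_apply] at this
              rw [pow_succ]; linarith
          -- If the geometric sequence is zero, the operator with one factor fewer already
          -- annihilates v.
          by_cases hs0 : s 0 = 0
          · exact ihj (by omega) (by ext n; rw [h1, hs0]; simp)
          · refine sign_constant_of_leading (b := b) (j := j) (by omega) hM (S b) (hSm b) ?_ v hv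
              (s 0) h1 hs0
            rw [hSl]
            have : (b + 1) * R ≤ (B + 1) * R := Nat.mul_le_mul_right _ hb
            have : (b + 1) * R = b * R + R := by ring
            omega
      exact step R le_rfl h
  exact main (B + 1) le_rfl (hlast ▸ h0)

/-! ### Restriction to residue classes modulo the period -/

/-- The subsequence of `u` along an arithmetic progression. -/
def decimate (P r : ℕ) : (ℕ → ℤ) →ₗ[ℤ] (ℕ → ℤ) where
  toFun u n := u (P * n + r)
  map_add' _ _ := rfl
  map_smul' _ _ := rfl

theorem decimate_apply (P r : ℕ) (u : ℕ → ℤ) (n : ℕ) : decimate P r u n = u (P * n + r) := rfl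

theorem aeval_decimate (P r : ℕ) (f : ℤ[X]) (u : ℕ → ℤ) :
    aeval shift f (decimate P r u) = decimate P r (aeval (shift ^ P) f u) := by
  induction f using Polynomial.induction_on' with
  | add p q hp hq => simp [hp, hq]
  | monomial m a =>
    ext n
    simp only [aeval_monomial, Module.End.mul_apply, Module.algebraMap_end_apply, Pi.smul_apply,
      decimate_apply, shift_pow_apply, ← pow_mul]
    congr 2; ring

/-- With only the roots 0 and 1 the growth rate β is 1, so the growth is polynomial. The class has
2R factors, and 4 is 2 (B + 1) for B = 1. -/
theorem abs_le_of_mem_cls_one {P R M : ℕ} (hP : 0 < P) {u : ℕ → ℤ} (hu : u ∈ cls P 1 R)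
    (hM : ∀ n < P * (2 * R + 1), |u n| ≤ M) (n : ℕ) :
    |u n| ≤ M * 4 ^ (2 * R) * (n + 1) ^ (2 * R) := by
  have h0 : aeval shift (rootProd 1 ^ R) (decimate P (n % P) u) = 0 := by
    rw [aeval_decimate, mem_cls.1 hu, map_zero]
  obtain ⟨S, h1, h2, h3⟩ := rootProd_pow_eq_listProd 1 R
  rw [h3] at h0
  have hr := Nat.mod_lt n hP
  have := abs_le_of_listProd_apply_eq_zero (β := 1) (B := 1) (K := 2 * R) (M := M) (by norm_num) S
    (fun b hb => ⟨h2 b hb, by exact_mod_cast h2 b hb⟩) _ h0 (by rw [h1])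
    (fun m hm => hM _ (by nlinarith)) (n / P)
  rw [decimate_apply, Nat.div_add_mod] at this
  norm_num at this
  have h4 : ((n / P : ℕ) : ℝ) ≤ n := by exact_mod_cast Nat.div_le_self n P
  have h5 : |(u n : ℝ)| ≤ M * 4 ^ (2 * R) * (n + 1) ^ (2 * R) := this.trans (by gcongr)
  exact_mod_cast h5

theorem sign_constant_of_mem_cls_decimate {P B R M : ℕ} (hP : 0 < P) (hM : 1 ≤ M) {u : ℕ → ℤ}
    (hu : u ∈ cls P B R) (hub : ∀ n < P * ((B + 1) * R + 1), |u n| ≤ M) (r : ℕ) (hr : r < P) :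
    (∀ n, (signConst B ((B + 1) * R) * M) ^ signExp ((B + 1) * R) ≤ n → 0 < u (P * n + r)) ∨
    (∀ n, (signConst B ((B + 1) * R) * M) ^ signExp ((B + 1) * R) ≤ n → u (P * n + r) ≤ 0) := by
  refine sign_constant_of_mem_cls hM (v := decimate P r u) ?_ fun n hn => hub _ (by nlinarith)
  rw [aeval_decimate, mem_cls.1 hu, map_zero]

/-! ### Periodic rational eigenvalues -/

/-- A prime power p^(k+1) dividing m satisfies p^k (p - 1) ≤ φ(m) ≤ n, hence p^(k+1) ≤ 2n. -/
theorem dvd_factorial_of_totient_le {m n : ℕ} (hm : 0 < m) (h : m.totient ≤ n) :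
    m ∣ (2 * n).factorial := by
  rw [Nat.dvd_iff_prime_pow_dvd_dvd]
  intro p k hp hpk
  refine Nat.dvd_factorial (Nat.pos_of_ne_zero (pow_ne_zero _ hp.ne_zero)) ?_
  rcases Nat.eq_zero_or_pos k with rfl | hk
  · have := Nat.totient_pos.2 hm
    rw [pow_zero]; omega
  have h1 := Nat.le_of_dvd (Nat.totient_pos.2 hm) (Nat.totient_dvd_of_dvd hpk)
  rw [Nat.totient_prime_pow hp hk] at h1
  obtain ⟨k, rfl⟩ : ∃ j, k = j + 1 := ⟨k - 1, by omega⟩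
  simp only [Nat.add_sub_cancel] at h1
  have h2 := hp.two_le
  calc p ^ (k + 1) = p ^ k * p := pow_succ _ _
    _ ≤ p ^ k * (2 * (p - 1)) := by gcongr; omega
    _ = 2 * (p ^ k * (p - 1)) := by ring
    _ ≤ 2 * n := by omega

/-- A common period of all periodic rational algebraic numbers of degree at most `n`. -/
def period (n : ℕ) : ℕ := n.factorial * (2 * n).factorial

theorem period_pos (n : ℕ) : 0 < period n := by
  unfold period; positivity

/-- All conjugates of z are roots of X^p - q, so they have the same modulus, and their product is
the constant coefficient up to sign. -/
theorem norm_pow_natDegree_eq {z : ℂ} (hz : IsIntegral ℚ z) {p : ℕ} (hp : 0 < p) {q : ℚ}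
    (h : z ^ p = q) : ‖z‖ ^ (minpoly ℚ z).natDegree = |((minpoly ℚ z).coeff 0 : ℝ)| := by
  have hm := minpoly.monic hz
  have hs := IsAlgClosed.splits ((minpoly ℚ z).map (algebraMap ℚ ℂ))
  have hr : ∀ w ∈ ((minpoly ℚ z).map (algebraMap ℚ ℂ)).roots, ‖w‖ = ‖z‖ := by
    intro w hw
    have hw' := (mem_roots'.1 hw).2
    have hd : minpoly ℚ z ∣ X ^ p - C q := minpoly.dvd _ _ (by simp [h])
    obtain ⟨g, hg⟩ := hd
    have hwp : w ^ p = q := by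
      have : aeval w (X ^ p - C q : ℚ[X]) = 0 := by
        rw [hg, map_mul, aeval_def, ← eval_map]
        rw [IsRoot] at hw'
        rw [hw', zero_mul]
      simpa [sub_eq_zero] using this
    have : ‖w‖ ^ p = ‖z‖ ^ p := by rw [← norm_pow, ← norm_pow, hwp, h]
    exact (pow_left_inj₀ (norm_nonneg _) (norm_nonneg _) hp.ne').1 this
  have h0 := hs.coeff_zero_eq_prod_roots_of_monic (hm.map _)
  have hc : Multiset.card ((minpoly ℚ z).map (algebraMap ℚ ℂ)).roots = (minpoly ℚ z).natDegree := by
    rw [← hs.natDegree_eq_card_roots, natDegree_map]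
  rw [coeff_map, natDegree_map] at h0
  have h1 := congrArg norm h0
  have h2 : ‖(algebraMap ℚ ℂ) ((minpoly ℚ z).coeff 0)‖ = |((minpoly ℚ z).coeff 0 : ℝ)| := by
    rw [eq_ratCast, ← Complex.ofReal_ratCast, Complex.norm_real, Real.norm_eq_abs]
  rw [← h2, h1, norm_mul, norm_pow, norm_neg, norm_one, one_pow, one_mul]
  rw [← hc]
  generalize ((minpoly ℚ z).map (algebraMap ℚ ℂ)).roots = s at hr
  induction s using Multiset.induction_on with
  | empty => simp
  | cons a s ih =>
    rw [Multiset.card_cons, pow_succ', Multiset.prod_cons, norm_mul, hr a (by simp),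
      ih fun w hw => hr w (by simp [hw])]

/-- With e the degree of z and c the absolute value of the constant coefficient of its minimal
polynomial, z^e = ζ c for a root of unity ζ in ℚ(z). The order m of ζ has φ(m) ≤ e ≤ n, so it
divides (2n)!. Thus z^(period n) is a power of c, which is nonnegative, rational and integral. -/
theorem pow_period_eq_nat {z : ℂ} (hz : IsPeriodicRational z) {f : ℤ[X]} (hf : f.Monic)
    (hfz : aeval z f = 0) {n : ℕ} (hn : f.natDegree ≤ n) : ∃ b : ℕ, z ^ period n = b := by
  rcases eq_or_ne z 0 with rfl | hz0
  · exact ⟨0, by simp [(period_pos n).ne']⟩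
  obtain ⟨p, hp, q, hq⟩ := hz
  have hint : IsIntegral ℤ z := ⟨f, hf, by rwa [← aeval_def]⟩
  have hintQ : IsIntegral ℚ z := hint.tower_top
  set e := (minpoly ℚ z).natDegree with he
  have he0 : 0 < e := minpoly.natDegree_pos hintQ
  have hen : e ≤ n := by
    have hd : minpoly ℚ z ∣ f.map (Int.castRingHom ℚ) := minpoly.dvd _ _ (by
      rw [← algebraMap_int_eq, aeval_map_algebraMap]; exact hfz)
    have := natDegree_le_of_dvd hd (hf.map _).ne_zero
    rw [hf.natDegree_map] at this
    omega
  set c : ℚ := |(minpoly ℚ z).coeff 0| with hc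
  have hnorm : ‖z‖ ^ e = (c : ℝ) := by
    rw [norm_pow_natDegree_eq hintQ hp hq, hc, Rat.cast_abs]
  have hc0 : 0 < c := by
    have : 0 < ‖z‖ ^ e := pow_pos (norm_pos_iff.2 hz0) _
    rw [hnorm] at this
    exact_mod_cast this
  have hcC : (c : ℂ) ≠ 0 := by exact_mod_cast hc0.ne'
  set ζ : ℂ := z ^ e / c with hζ
  have hζn : ‖ζ‖ = 1 := by
    have : ‖(c : ℂ)‖ = (c : ℝ) := by
      rw [← Complex.ofReal_ratCast, Complex.norm_real, Real.norm_eq_abs, abs_of_pos]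
      exact_mod_cast hc0
    rw [hζ, norm_div, norm_pow, hnorm, this, div_self]
    exact_mod_cast hc0.ne'
  -- ζ^p is rational of absolute value 1, hence ±1.
  have hζp : ζ ^ (2 * p) = 1 := by
    have e1 : ζ ^ p = ((q ^ e / c ^ p : ℚ) : ℂ) := by
      rw [hζ, div_pow, ← pow_mul, mul_comm e p, pow_mul, hq]; push_cast; rfl
    have e2 : |(q ^ e / c ^ p : ℚ)| = 1 := by
      have : ‖ζ ^ p‖ = 1 := by rw [norm_pow, hζn, one_pow]
      rw [e1, ← Complex.ofReal_ratCast, Complex.norm_real, Real.norm_eq_abs] at this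
      exact_mod_cast this
    rw [mul_comm, pow_mul, e1, ← Rat.cast_pow, ← sq_abs, e2]; simp
  have hfin : IsOfFinOrder ζ := isOfFinOrder_iff_pow_eq_one.2 ⟨2 * p, by omega, hζp⟩
  have hprim := IsPrimitiveRoot.orderOf ζ
  set m := orderOf ζ with hm
  have hm0 : 0 < m := hfin.orderOf_pos
  have htot : m.totient ≤ n := by
    have hmem : ζ ∈ IntermediateField.adjoin ℚ {z} := by
      rw [hζ]
      refine div_mem (pow_mem (IntermediateField.mem_adjoin_simple_self ℚ z) _) ?_
      exact SubfieldClass.ratCast_mem _ c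
    have h1 : (minpoly ℚ ζ).natDegree ≤ e := by
      have := IntermediateField.adjoin.finiteDimensional hintQ
      have h2 := minpoly.natDegree_le (A := ℚ) (⟨ζ, hmem⟩ : IntermediateField.adjoin ℚ {z})
      rw [IntermediateField.adjoin.finrank hintQ] at h2
      rwa [← minpoly.algebraMap_eq (algebraMap (IntermediateField.adjoin ℚ {z}) ℂ).injective] at h2
    rw [← cyclotomic_eq_minpoly_rat hprim hm0, natDegree_cyclotomic] at h1
    omega
  have hd := dvd_factorial_of_totient_le hm0 htot
  have h1 : ζ ^ (2 * n).factorial = 1 := orderOf_dvd_iff_pow_eq_one.1 hd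
  have h2 : z ^ e = ζ * c := by rw [hζ]; field_simp
  obtain ⟨k, hk⟩ := Nat.dvd_factorial he0 hen
  set r : ℚ := c ^ (k * (2 * n).factorial) with hr
  have h3 : z ^ period n = (r : ℂ) := by
    have : period n = e * ((2 * n).factorial * k) := by rw [period, hk]; ring
    rw [this, pow_mul, h2, mul_pow, pow_mul, h1, one_pow, one_mul, hr]; push_cast
    rw [mul_comm k]
  have h4 : IsIntegral ℤ r := by
    have := hint.pow (period n)
    rw [h3] at this
    exact (isIntegral_algebraMap_iff (algebraMap ℚ ℂ).injective).1 (by simpa using this)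
  obtain ⟨y, hy⟩ := IsIntegrallyClosed.isIntegral_iff.1 h4
  have hy' : (y : ℚ) = r := by simpa using hy
  have hr0 : 0 ≤ r := by positivity
  have : 0 ≤ y := by rw [← hy'] at hr0; exact_mod_cast hr0
  obtain ⟨b, rfl⟩ := Int.eq_ofNat_of_zero_le this
  exact ⟨b, by rw [h3, ← hy']; simp⟩

/-! ### Orbits of solvable loops and the Jacobian at the origin -/

namespace Loop

variable {d : ℕ}

/-- One iteration of the update on states. -/
noncomputable def step (L : Loop d) (σ : Fin d → ℤ) : Fin d → ℤ :=
  fun i => MvPolynomial.eval σ (L.update i)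

theorem eval_bind₁_iterate (L : Loop d) (n : ℕ) (q : MvPolynomial (Fin d) ℤ) (σ : Fin d → ℤ) :
    MvPolynomial.eval σ ((MvPolynomial.bind₁ L.update)^[n] q) =
      MvPolynomial.eval (L.step^[n] σ) q := by
  induction n generalizing σ with
  | zero => rfl
  | succ n ih =>
    rw [Function.iterate_succ_apply', Function.iterate_succ_apply, ← ih]
    exact MvPolynomial.eval₂Hom_bind₁ _ _ _ _

theorem eval_iter (L : Loop d) (n : ℕ) (i : Fin d) (σ : Fin d → ℤ) :
    MvPolynomial.eval σ (L.iter n i) = (L.step^[n] σ) i := by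
  rw [iter, eval_bind₁_iterate, MvPolynomial.eval_X]

theorem holds_map_bind₁ (L : Loop d) (φ : Formula (MvPolynomial (Fin d) ℚ)) (σ : Fin d → ℤ) :
    (Formula.map (MvPolynomial.bind₁ fun i =>
      MvPolynomial.map (Int.castRingHom ℚ) (L.update i)) φ).Holds σ ↔ φ.Holds (L.step σ) := by
  induction φ with
  | pos p =>
    simp only [Formula.map, Formula.Holds]
    have : MvPolynomial.eval (fun i => (σ i : ℚ)) (MvPolynomial.bind₁ (fun i =>
        MvPolynomial.map (Int.castRingHom ℚ) (L.update i)) p) =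
        MvPolynomial.eval (fun i => (L.step σ i : ℚ)) p := by
      refine (MvPolynomial.eval₂Hom_bind₁ _ _ _ _).trans ?_
      congr 2
      ext i
      rw [step, MvPolynomial.eval₂Hom_map_hom, MvPolynomial.coe_eval₂Hom]
      rw [MvPolynomial.eval_eq, MvPolynomial.eval₂_eq]
      simp
    rw [this]
  | and φ ψ h1 h2 => simp only [Formula.map, Formula.Holds, h1, h2]
  | or φ ψ h1 h2 => simp only [Formula.map, Formula.Holds, h1, h2]

theorem holds_iterGuard (L : Loop d) (n : ℕ) (σ : Fin d → ℤ) :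
    (L.iterGuard n).Holds σ ↔ L.guard.Holds (L.step^[n] σ) := by
  rw [iterGuard]
  induction n generalizing σ with
  | zero => rfl
  | succ n ih => rw [Function.iterate_succ_apply', holds_map_bind₁, ih, Function.iterate_succ_apply]

/-- The linear parts of the update polynomials. -/
noncomputable def jac (L : Loop d) : Matrix (Fin d) (Fin d) ℤ :=
  Matrix.of fun i k => (L.update i).coeff (Finsupp.single k 1)

variable {L : Loop d} (S : L.SolvablePartition)

namespace SolvablePartition

theorem update_apply (j : Fin d) : L.update j =
    (∑ k, MvPolynomial.C (S.A (S.block j) ⟨j, rfl⟩ k) * MvPolynomial.X (k : Fin d)) + S.p j :=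
  S.update_eq (S.block j) ⟨j, rfl⟩

theorem coeff_p_eq_zero {j k : Fin d} (h : S.block j ≤ S.block k) :
    (S.p j).coeff (Finsupp.single k 1) = 0 := by
  by_contra h0
  have := S.p_vars j k ((MvPolynomial.mem_vars_iff_mem_support k).2
    ⟨_, MvPolynomial.mem_support_iff.2 h0, by simp⟩)
  exact absurd this (not_lt.2 h)

theorem jac_apply_of_block_eq {i : Fin S.m} (j k : {j : Fin d // S.block j = i}) :
    L.jac j k = S.A i j k := by
  rw [jac, Matrix.of_apply, S.update_eq i j, MvPolynomial.coeff_add,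
    S.coeff_p_eq_zero (by rw [j.2, k.2]), add_zero, MvPolynomial.coeff_sum]
  simp only [MvPolynomial.coeff_C_mul, MvPolynomial.coeff_X]
  rw [Finset.sum_eq_single k]
  · simp
  · intro b _ hb
    rw [if_neg fun h => hb (Subtype.ext (Finsupp.single_left_injective one_ne_zero h)), mul_zero]
  · simp

theorem jac_apply_of_lt {j k : Fin d} (h : S.block j < S.block k) : L.jac j k = 0 := by
  rw [jac, Matrix.of_apply, S.update_apply j, MvPolynomial.coeff_add,
    S.coeff_p_eq_zero h.le, add_zero, MvPolynomial.coeff_sum]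
  refine Finset.sum_eq_zero fun b _ => ?_
  rw [MvPolynomial.coeff_C_mul, MvPolynomial.coeff_X, if_neg, mul_zero]
  intro hb
  have hb' := b.2
  rw [Finsupp.single_left_injective one_ne_zero hb] at hb'
  exact absurd hb' h.ne'

/-- The matrix of linear coefficients is block triangular for the order of the blocks, with the A_i
on the diagonal: the polynomials p_i may contribute linear terms only in variables of lower blocks.
-/
theorem charpoly_jac : L.jac.charpoly = ∏ i : Fin S.m, (S.A i).charpoly := by
  have hb : Matrix.BlockTriangular L.jac.transpose S.block := by
    intro j k h
    exact S.jac_apply_of_lt h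
  rw [← Matrix.charpoly_transpose, hb.charpoly, Finset.image_univ_of_surjective S.block_surjective]
  refine Finset.prod_congr rfl fun i _ => ?_
  rw [← Matrix.charpoly_transpose (S.A i)]
  congr 1
  ext j k
  exact S.jac_apply_of_block_eq k j

theorem totalDegree_p_le {N : ℕ} (hN : 1 ≤ N) (h : ∀ i, (L.update i).totalDegree ≤ N)
    (j : Fin d) : (S.p j).totalDegree ≤ N := by
  have : S.p j = L.update j -
      ∑ k, MvPolynomial.C (S.A (S.block j) ⟨j, rfl⟩ k) * MvPolynomial.X (k : Fin d) := by
    rw [S.update_apply j]; ring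
  rw [this]
  refine (MvPolynomial.totalDegree_sub _ _).trans (max_le (h j) ?_)
  refine MvPolynomial.totalDegree_finsetSum_le fun k _ => ?_
  refine (MvPolynomial.totalDegree_mul _ _).trans ?_
  rw [MvPolynomial.totalDegree_C, MvPolynomial.totalDegree_X]
  omega

theorem isEigenvalue_of_aeval_charpoly {i : Fin S.m} {z : ℂ} (h : aeval z (S.A i).charpoly = 0) :
    S.IsEigenvalue z := by
  refine ⟨i, ?_⟩
  rw [Module.End.hasEigenvalue_iff_isRoot_charpoly, Matrix.charpoly_toLin', IsRoot]
  have := Matrix.charpoly_map (S.A i) (Int.castRingHom ℂ)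
  have e : (S.A i).map (fun a : ℤ => (a : ℂ)) = (S.A i).map (Int.castRingHom ℂ) := rfl
  rw [e, this, eval_map]
  exact h

theorem m_le : S.m ≤ d := by
  simpa using Fintype.card_le_of_surjective _ S.block_surjective

end SolvablePartition

end Loop

/-- The multiplicities that suffice for the orbits of the variables in the first `i` blocks. -/
def levelMult (B N : ℕ) : ℕ → ℕ
  | 0 => 0
  | i + 1 => prodMult (B ^ N ^ i) (levelMult B N i) N + N

theorem le_prodMult (B R : ℕ) {N : ℕ} (hN : 1 ≤ N) : R ≤ prodMult B R N := by
  obtain ⟨N, rfl⟩ : ∃ k, N = k + 1 := ⟨N - 1, by omega⟩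
  rw [prodMult]
  nlinarith [Nat.zero_le ((B ^ N + 1) * prodMult B R N), Nat.zero_le (B * R)]

theorem levelMult_mono (B : ℕ) {N : ℕ} (hN : 1 ≤ N) : Monotone (levelMult B N) :=
  monotone_nat_of_le_succ fun _ => (le_prodMult _ _ hN).trans (Nat.le_add_right _ _)

namespace Loop

variable {d : ℕ} {L : Loop d}

/-- Induction over the blocks. On the next block the p_i are polynomials of degree at most N in
sequences already treated, which raises the base to its N-th power. Solving the linear system adds
at most N to the multiplicity. -/
theorem orbit_mem_cls (S : L.SolvablePartition) {P B N : ℕ} (hN : 1 ≤ N) (hB : 1 ≤ B)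
    (hd : d ≤ N) (hdeg : ∀ i, (L.update i).totalDegree ≤ N)
    (hS : ∀ i, ∀ z : ℂ, aeval z (S.A i).charpoly = 0 → ∃ b : ℕ, b ≤ B ∧ z ^ P = b)
    (σ : Fin d → ℤ) (j : Fin d) :
    (fun n => (L.step^[n] σ) j) ∈ cls P (B ^ N ^ N) (levelMult B N N) := by
  have hNm : ∀ i, B ^ N ^ i ≤ B ^ N ^ (i + 1) := fun i =>
    Nat.pow_le_pow_right hB (Nat.pow_le_pow_right hN (by omega))
  have main : ∀ i : ℕ, ∀ j, (S.block j : ℕ) < i →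
      (fun n => (L.step^[n] σ) j) ∈ cls P (B ^ N ^ i) (levelMult B N i) := by
    intro i
    induction i with
    | zero => intro j hj; omega
    | succ i ih =>
      intro j hj
      rcases Nat.lt_succ_iff_lt_or_eq.1 hj with h | h
      · exact cls_mono (hNm i) (levelMult_mono B hN (by omega)) (ih j h)
      have hq : ∀ k : {k : Fin d // S.block k = S.block j},
          (fun n => MvPolynomial.eval (L.step^[n] σ) (S.p k)) ∈
            cls P (B ^ N ^ (i + 1)) (prodMult (B ^ N ^ i) (levelMult B N i) N) := by
        intro k
        rw [pow_succ N i, pow_mul]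
        refine mvPolynomial_mem_cls (S.p k) (fun l n => (L.step^[n] σ) l) (Nat.one_le_pow _ _ hB)
          (S.totalDegree_p_le hN hdeg k) fun l hl => ih l ?_
        have := S.p_vars k l hl
        rw [k.2] at this
        rw [← h]; exact this
      refine mem_cls_of_linear_system (S.A (S.block j))
        (fun k n => (L.step^[n] σ) (k : Fin d))
        (fun k n => MvPolynomial.eval (L.step^[n] σ) (S.p k)) ?_ ?_ ?_ hq ⟨j, rfl⟩
      · intro k
        ext n
        rw [shift_apply, Function.iterate_succ_apply', step, S.update_eq _ k]
        simp
      · refine le_trans ?_ hd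
        simpa using Fintype.card_subtype_le (fun k => S.block k = S.block j)
      · intro z hz
        obtain ⟨b, hb, hzb⟩ := hS _ z hz
        exact ⟨b, hb.trans (Nat.le_self_pow (by positivity) B), hzb⟩
  have := main S.m j (S.block j).2
  have hm := S.m_le.trans hd
  exact cls_mono (Nat.pow_le_pow_right hB (Nat.pow_le_pow_right hN hm))
    (levelMult_mono B hN hm) this

/-- A bound for the entries of an integer matrix bounds its eigenvalues. -/
theorem norm_le_of_aeval_charpoly_eq_zero {ι : Type} [Fintype ι] [DecidableEq ι]
    (A : Matrix ι ι ℤ) {N : ℕ} (hc : Fintype.card ι ≤ N) (hA : ∀ i j, |A i j| ≤ N) {z : ℂ}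
    (hz : aeval z A.charpoly = 0) : ‖z‖ ≤ N ^ 2 := by
  have hev : Module.End.HasEigenvalue (Matrix.toLin' (A.map (Int.castRingHom ℂ))) z := by
    rw [Module.End.hasEigenvalue_iff_isRoot_charpoly, Matrix.charpoly_toLin', IsRoot,
      Matrix.charpoly_map, eval_map]
    exact hz
  obtain ⟨v, hv⟩ := hev.exists_hasEigenvector
  have hv0 := hv.2
  have hne : Nonempty ι := by
    by_contra h
    rw [not_nonempty_iff] at h
    exact hv0 (Subsingleton.elim _ _)
  -- The eigenvector equation is read at a coordinate of largest modulus.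
  obtain ⟨i, -, hi⟩ := Finset.exists_max_image Finset.univ (fun i => ‖v i‖) Finset.univ_nonempty
  have hvi : 0 < ‖v i‖ := by
    rw [norm_pos_iff]
    intro h
    refine hv0 (funext fun j => ?_)
    have := hi j (Finset.mem_univ _)
    rw [h, norm_zero] at this
    simpa using le_antisymm this (norm_nonneg _)
  have e := congrFun hv.apply_eq_smul i
  rw [Matrix.toLin'_apply, Pi.smul_apply, smul_eq_mul, Matrix.mulVec, dotProduct] at e
  have h1 : ‖z‖ * ‖v i‖ ≤ N ^ 2 * ‖v i‖ := by
    rw [← norm_mul, ← e]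
    calc _ ≤ ∑ j, ‖(A.map (Int.castRingHom ℂ)) i j * v j‖ := norm_sum_le _ _
      _ ≤ ∑ j : ι, (N : ℝ) * ‖v i‖ := by
        refine Finset.sum_le_sum fun j _ => ?_
        rw [norm_mul]
        refine mul_le_mul ?_ (hi j (Finset.mem_univ _)) (norm_nonneg _) (by positivity)
        rw [Matrix.map_apply, eq_intCast, Complex.norm_intCast]
        exact_mod_cast hA i j
      _ = (Fintype.card ι : ℝ) * (N * ‖v i‖) := by simp
      _ ≤ N * (N * ‖v i‖) := by gcongr
      _ = _ := by ring
  exact le_of_mul_le_mul_right h1 hvi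

theorem exists_pow_period_eq (S : L.SolvablePartition)
    (hS : ∀ z : ℂ, S.IsEigenvalue z → IsPeriodicRational z) {N : ℕ}
    (hd : d ≤ N) (hJ : ∀ i k, |L.jac i k| ≤ N) (i : Fin S.m) (z : ℂ)
    (hz : aeval z (S.A i).charpoly = 0) : ∃ b : ℕ, b ≤ N ^ (2 * period N) ∧ z ^ period N = b := by
  have hcard : Fintype.card {j : Fin d // S.block j = i} ≤ N := by
    refine le_trans ?_ hd
    simpa using Fintype.card_subtype_le (fun k => S.block k = i)
  obtain ⟨b, hb⟩ := pow_period_eq_nat (hS z (S.isEigenvalue_of_aeval_charpoly hz))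
    (S.A i).charpoly_monic hz (n := N) (by rw [Matrix.charpoly_natDegree_eq_dim]; exact hcard)
  refine ⟨b, ?_, hb⟩
  have h1 := norm_le_of_aeval_charpoly_eq_zero (S.A i) hcard
    (fun j k => by rw [← S.jac_apply_of_block_eq]; exact hJ _ _) hz
  have h2 : (b : ℝ) = ‖z‖ ^ period N := by rw [← norm_pow, hb, Complex.norm_natCast]
  have h3 : (b : ℝ) ≤ (N ^ 2) ^ period N := by rw [h2]; gcongr
  rw [pow_mul]; exact_mod_cast h3

/-! ### The test for unit loops -/

/-- A test for all eigenvalues `z` to satisfy `z ^ period N ∈ {0, 1}`. -/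
def UnitTest (L : Loop d) (N : ℕ) : Prop :=
  (L.jac ^ period N * (L.jac ^ period N - 1)) ^ N = 0

theorem unitTest_iff (L : Loop d) (N : ℕ) :
    L.UnitTest N ↔ aeval (L.jac ^ period N) (rootProd 1 ^ N) = 0 := by
  rw [UnitTest, map_pow, rootProd, Finset.prod_range_succ, Finset.prod_range_one]
  simp

/-- A P-th power of an eigenvalue is a natural number of modulus at most 1, hence 0 or 1. So the
characteristic polynomial divides (X^P (X^P - 1))^N, and Cayley–Hamilton applies. -/
theorem unitTest_of_isUnitPRS (h : L.IsUnitPRS) {N : ℕ} (hd : d ≤ N) : L.UnitTest N := by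
  obtain ⟨S, hS⟩ := h
  rw [unitTest_iff, ← expand_aeval]
  obtain ⟨g, hg⟩ := dvd_expand_rootProd_pow L.jac.charpoly_monic (P := period N) (B := 1) (n := N)
    (by rw [Matrix.charpoly_natDegree_eq_dim]; simpa using hd) (fun z hz => by
      rw [S.charpoly_jac, map_prod, Finset.prod_eq_zero_iff] at hz
      obtain ⟨i, -, hz⟩ := hz
      have hzi := hS z (S.isEigenvalue_of_aeval_charpoly hz)
      obtain ⟨b, hb⟩ := pow_period_eq_nat hzi.1 (S.A i).charpoly_monic hz (n := N) (by
        rw [Matrix.charpoly_natDegree_eq_dim]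
        refine le_trans ?_ hd
        simpa using Fintype.card_subtype_le (fun k => S.block k = i))
      refine ⟨b, ?_, hb⟩
      have h2 : (b : ℝ) = ‖z‖ ^ period N := by rw [← norm_pow, hb, Complex.norm_natCast]
      have h3 : (b : ℝ) ≤ 1 := by rw [h2]; exact pow_le_one₀ (norm_nonneg _) hzi.2
      exact_mod_cast h3)
  rw [hg, map_mul, Matrix.aeval_self_charpoly, zero_mul]

/-- Conversely, a polynomial that annihilates the matrix vanishes at its eigenvalues. A passed test
thus supplies what the polynomial size bound needs from the eigenvalues. -/
theorem UnitTest.exists_pow_period_eq {N : ℕ} (h : L.UnitTest N) (S : L.SolvablePartition)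
    (i : Fin S.m) (z : ℂ) (hz : aeval z (S.A i).charpoly = 0) :
    ∃ b : ℕ, b ≤ 1 ∧ z ^ period N = b := by
  rw [unitTest_iff, ← expand_aeval] at h
  have hzJ : aeval z L.jac.charpoly = 0 := by
    rw [S.charpoly_jac, map_prod]
    exact Finset.prod_eq_zero (Finset.mem_univ i) hz
  have hev : Module.End.HasEigenvalue (Matrix.toLin' (L.jac.map (Int.castRingHom ℂ))) z := by
    rw [Module.End.hasEigenvalue_iff_isRoot_charpoly, Matrix.charpoly_toLin', IsRoot,
      Matrix.charpoly_map, eval_map]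
    exact hzJ
  set f := expand ℤ (period N) (rootProd 1 ^ N) with hf
  have h1 : aeval (Matrix.toLin' (L.jac.map (Int.castRingHom ℂ))) (f.map (Int.castRingHom ℂ)) = 0 := by
    have e1 : aeval (L.jac.map (Int.castRingHom ℂ)) (f.map (Int.castRingHom ℂ)) = 0 := by
      have e2 := Polynomial.aeval_algHom_apply (Int.castRingHom ℂ).mapMatrix.toIntAlgHom L.jac f
      rw [h, map_zero] at e2
      rw [← algebraMap_int_eq, aeval_map_algebraMap]
      exact e2
    have e3 := Polynomial.aeval_algHom_apply (Matrix.toLinAlgEquiv' (R := ℂ) (n := Fin d)).toAlgHom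
      (L.jac.map (Int.castRingHom ℂ)) (f.map (Int.castRingHom ℂ))
    rw [e1, map_zero] at e3
    exact e3
  obtain ⟨v, hv⟩ := hev.exists_hasEigenvector
  have h2 := Module.End.aeval_apply_of_hasEigenvector (p := f.map (Int.castRingHom ℂ)) hv
  rw [h1, LinearMap.zero_apply] at h2
  have h3 := (smul_eq_zero.1 h2.symm).resolve_right hv.2
  rw [hf, map_expand, expand_eval, eval_map, eval₂_pow] at h3
  have h4 := eq_zero_of_pow_eq_zero h3
  rw [rootProd, Finset.prod_range_succ, Finset.prod_range_one] at h4
  simp only [Nat.cast_zero, map_zero, sub_zero, Nat.cast_one, map_one, eval₂_mul, eval₂_X,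
    eval₂_sub, eval₂_one, mul_eq_zero] at h4
  rcases h4 with h4 | h4
  · exact ⟨0, by omega, by simpa using h4⟩
  · exact ⟨1, le_rfl, by simpa [sub_eq_zero] using h4⟩

end Loop

/-! ### Explicit growth estimates and the runtime bound -/

/-- All atoms of a formula satisfy `Q`. -/
def Formula.Forall {α : Type} (Q : α → Prop) : Formula α → Prop
  | pos p => Q p
  | and φ ψ => Forall Q φ ∧ Forall Q ψ
  | or φ ψ => Forall Q φ ∧ Forall Q ψ

/-- One plus the sum of the absolute values of the variables. -/
def sumAbs {d : ℕ} (σ : Fin d → ℤ) : ℕ := 1 + ∑ i, (σ i).natAbs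

theorem one_le_sumAbs {d : ℕ} (σ : Fin d → ℤ) : 1 ≤ sumAbs σ := Nat.le_add_right _ _

theorem natAbs_le_sumAbs {d : ℕ} (σ : Fin d → ℤ) (i : Fin d) : (σ i).natAbs ≤ sumAbs σ :=
  (Finset.single_le_sum (f := fun i => (σ i).natAbs) (fun _ _ => Nat.zero_le _)
    (Finset.mem_univ i)).trans (Nat.le_add_left _ _)

/-- The number `N` bounds the degree of `q` and the growth of its values. -/
def PolyBoundedBy {d : ℕ} (N : ℕ) (q : MvPolynomial (Fin d) ℤ) : Prop :=
  q.totalDegree ≤ N ∧ ∀ σ, (MvPolynomial.eval σ q).natAbs ≤ N * sumAbs σ ^ N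

/-- The number `N` bounds the dimension, the degrees and the coefficients of a loop. -/
structure Loop.BoundedBy {d : ℕ} (L : Loop d) (N : ℕ) : Prop where
  pos : 1 ≤ N
  dim_le : d ≤ N
  update : ∀ i, PolyBoundedBy N (L.update i)
  jac_le : ∀ i k, |L.jac i k| ≤ N
  guard : L.guard.Forall fun p => ∃ g : MvPolynomial (Fin d) ℤ, PolyBoundedBy N g ∧
    ∀ σ : Fin d → ℤ, 0 < MvPolynomial.eval (fun i => (σ i : ℚ)) p ↔ 0 < MvPolynomial.eval σ g

/-- The growth rate `c` such that one iteration takes `s` to at most `(c s) ^ c`. -/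
def growthConst (N : ℕ) : ℕ := N ^ 2 + 1

/-- The degree in the start values of the values after `n` iterations. -/
def growthExp (N n : ℕ) : ℕ := (2 * growthConst N) ^ n

theorem growthExp_mono (N : ℕ) : Monotone (growthExp N) := fun _ _ h =>
  Nat.pow_le_pow_right (by unfold growthConst; omega) h

theorem one_le_growthExp (N n : ℕ) : 1 ≤ growthExp N n :=
  Nat.one_le_pow _ _ (by unfold growthConst; omega)

namespace Loop.BoundedBy

variable {d : ℕ} {L : Loop d} {N : ℕ}

theorem sumAbs_step_le (h : L.BoundedBy N) (σ : Fin d → ℤ) :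
    sumAbs (L.step σ) ≤ (growthConst N * sumAbs σ) ^ growthConst N := by
  have hs := one_le_sumAbs σ
  calc sumAbs (L.step σ) ≤ 1 + ∑ _i : Fin d, N * sumAbs σ ^ N := by
        unfold sumAbs
        gcongr with i
        exact (h.update i).2 σ
    _ = 1 + d * (N * sumAbs σ ^ N) := by simp
    _ ≤ sumAbs σ ^ N + N * (N * sumAbs σ ^ N) := by
        gcongr
        · exact Nat.one_le_pow _ _ hs
        · exact h.dim_le
    _ = growthConst N * sumAbs σ ^ N := by unfold growthConst; ring
    _ ≤ growthConst N ^ growthConst N * sumAbs σ ^ growthConst N := by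
        have h0 : growthConst N ≠ 0 := by unfold growthConst; omega
        gcongr
        · exact Nat.le_self_pow h0 _
        · unfold growthConst; nlinarith
    _ = _ := (mul_pow _ _ _).symm

theorem sumAbs_iterate_le (h : L.BoundedBy N) (σ : Fin d → ℤ) (n : ℕ) :
    sumAbs (L.step^[n] σ) ≤ (growthConst N * sumAbs σ) ^ growthExp N n := by
  have hs := one_le_sumAbs σ
  have hc : 1 ≤ growthConst N := by unfold growthConst; omega
  induction n with
  | zero => simpa [growthExp] using Nat.le_mul_of_pos_left _ hc
  | succ n ih =>
    rw [Function.iterate_succ_apply']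
    refine (h.sumAbs_step_le _).trans ?_
    have hcs : 1 ≤ growthConst N * sumAbs σ := Nat.one_le_iff_ne_zero.2 (by positivity)
    calc _ ≤ (growthConst N * sumAbs σ * (growthConst N * sumAbs σ) ^ growthExp N n) ^
          growthConst N := by
          gcongr
          exact Nat.le_mul_of_pos_right _ hs
      _ = (growthConst N * sumAbs σ) ^ ((growthExp N n + 1) * growthConst N) := by
          rw [← pow_succ', ← pow_mul]
      _ ≤ _ := by
          -- The exponents satisfy (E + 1) c ≤ E · 2c because E ≥ 1; this is why `growthExp` has
          -- base 2c.
          refine Nat.pow_le_pow_right hcs ?_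
          have h1 := one_le_growthExp N n
          have h2 : growthExp N (n + 1) = growthExp N n * (2 * growthConst N) := pow_succ _ _
          rw [h2]
          nlinarith

theorem natAbs_iterate_le (h : L.BoundedBy N) (σ : Fin d → ℤ) {n m : ℕ} (hn : n ≤ m) (i : Fin d) :
    ((L.step^[n] σ) i).natAbs ≤ (growthConst N * sumAbs σ) ^ growthExp N m := by
  refine ((natAbs_le_sumAbs _ i).trans (h.sumAbs_iterate_le σ n)).trans
    (Nat.pow_le_pow_right ?_ (growthExp_mono N hn))
  exact Nat.mul_pos (by unfold growthConst; omega) (one_le_sumAbs σ)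

end Loop.BoundedBy

/-- A bound for the `period N`-th powers of the eigenvalues. -/
def eigBound (N : ℕ) : ℕ := N ^ (2 * period N)

/-- The bases of the exponentials in the values of the guard atoms along an orbit. -/
def atomBase (N : ℕ) : ℕ := (eigBound N ^ N ^ N) ^ N

/-- The multiplicity of each base for the guard atoms. -/
def atomMult (N : ℕ) : ℕ := prodMult (eigBound N ^ N ^ N) (levelMult (eigBound N) N N) N

/-- The order of the recurrences for the guard atoms. -/
def atomOrder (N : ℕ) : ℕ := (atomBase N + 1) * atomMult N

/-- The degree of the first values of the guard atoms. -/
def atomExp (N : ℕ) : ℕ := growthExp N (period N * (atomOrder N + 1)) * N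

/-- The constant of the polynomial runtime bound. -/
def runtimeConst (N : ℕ) : ℕ :=
  2 * period N * (signConst (atomBase N) (atomOrder N) * N) * growthConst N +
    atomExp N * signExp (atomOrder N)

namespace Loop.BoundedBy

variable {d : ℕ} {L : Loop d} {N : ℕ}

/-- The time after which the guard has constant truth values in each residue class. -/
def stableTime (N : ℕ) (σ : Fin d → ℤ) : ℕ :=
  (signConst (atomBase N) (atomOrder N) * (N * (growthConst N * sumAbs σ) ^ atomExp N)) ^
    signExp (atomOrder N)

theorem atom_sign_constant (h : L.BoundedBy N) (hL : L.IsPRS) {g : MvPolynomial (Fin d) ℤ}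
    (hg : PolyBoundedBy N g) (σ : Fin d → ℤ) (r : ℕ) (hr : r < period N) :
    (∀ n, stableTime N σ ≤ n → 0 < MvPolynomial.eval (L.step^[period N * n + r] σ) g) ∨
    (∀ n, stableTime N σ ≤ n → MvPolynomial.eval (L.step^[period N * n + r] σ) g ≤ 0) := by
  obtain ⟨S, hS⟩ := hL
  have hN := h.pos
  have hB : 1 ≤ eigBound N := Nat.one_le_pow _ _ hN
  have hcs : 1 ≤ growthConst N * sumAbs σ :=
    Nat.mul_pos (by unfold growthConst; omega) (one_le_sumAbs σ)
  have hcls : (fun n => MvPolynomial.eval (L.step^[n] σ) g) ∈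
      cls (period N) (atomBase N) (atomMult N) :=
    mvPolynomial_mem_cls g (fun l n => (L.step^[n] σ) l) (Nat.one_le_pow _ _ hB) hg.1
      fun l _ => orbit_mem_cls S hN hB h.dim_le (fun i => (h.update i).1)
        (exists_pow_period_eq S hS h.dim_le h.jac_le) σ l
  refine sign_constant_of_mem_cls_decimate (period_pos N)
    (M := N * (growthConst N * sumAbs σ) ^ atomExp N)
    (Nat.mul_pos hN (Nat.pow_pos hcs)) hcls (fun n hn => ?_) r hr
  have h1 := hg.2 (L.step^[n] σ)
  have h2 := h.sumAbs_iterate_le σ n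
  have h3 : (MvPolynomial.eval (L.step^[n] σ) g).natAbs ≤
      N * (growthConst N * sumAbs σ) ^ atomExp N := by
    refine h1.trans ?_
    refine Nat.mul_le_mul_left N ?_
    calc _ ≤ ((growthConst N * sumAbs σ) ^ growthExp N n) ^ N := by gcongr
      _ = (growthConst N * sumAbs σ) ^ (growthExp N n * N) := (pow_mul _ _ _).symm
      _ ≤ _ := Nat.pow_le_pow_right hcs (Nat.mul_le_mul_right _ (growthExp_mono N hn.le))
  rw [Int.abs_eq_natAbs]
  exact_mod_cast h3

/-- The truth value of a formula depends only on which atoms are positive, and each of these is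
settled on the residue class after `stableTime`. -/
theorem guard_constant (h : L.BoundedBy N) (hL : L.IsPRS) (σ : Fin d → ℤ) (r : ℕ)
    (hr : r < period N) (n : ℕ) (hn : stableTime N σ ≤ n) :
    L.guard.Holds (L.step^[period N * n + r] σ) ↔
      L.guard.Holds (L.step^[period N * stableTime N σ + r] σ) := by
  have hg := h.guard
  generalize L.guard = φ at hg ⊢
  induction φ with
  | pos p =>
    obtain ⟨g, hgb, hgp⟩ := hg
    simp only [Formula.Holds, hgp]
    rcases h.atom_sign_constant hL hgb σ r hr with h1 | h1
    · simp only [h1 n hn, h1 _ le_rfl]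
    · simp only [not_lt.2 (h1 n hn), not_lt.2 (h1 _ le_rfl)]
  | and φ ψ h1 h2 => simp only [Formula.Holds, h1 hg.1, h2 hg.2]
  | or φ ψ h1 h2 => simp only [Formula.Holds, h1 hg.1, h2 hg.2]

/-- Brings the threshold into the form (K s)^K. `runtimeConst` is the sum of the required base and
exponent, so it dominates both. -/
theorem stableTime_le (hN : 1 ≤ N) (σ : Fin d → ℤ) :
    period N * (stableTime N σ + 1) ≤ (runtimeConst N * sumAbs σ) ^ runtimeConst N := by
  have hs := one_le_sumAbs σ
  have hP := period_pos N
  have hc : 1 ≤ growthConst N := by unfold growthConst; omega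
  have hSC : 1 ≤ signConst (atomBase N) (atomOrder N) := by
    have := add_two_le_signConst (atomBase N) (atomOrder N); omega
  have hSE : 1 ≤ signExp (atomOrder N) := by
    unfold signExp; nlinarith [Nat.one_le_pow (atomOrder N) (atomOrder N + 3) (by omega)]
  have hE : 1 ≤ atomExp N := Nat.mul_pos (one_le_growthExp _ _) hN
  set SC := signConst (atomBase N) (atomOrder N) * N with hSCdef
  have hSC' : 1 ≤ SC := Nat.mul_pos hSC hN
  have h0 : 1 ≤ stableTime N σ := by
    unfold stableTime
    refine Nat.one_le_pow _ _ (Nat.mul_pos hSC (Nat.mul_pos hN (Nat.pow_pos (Nat.mul_pos hc hs))))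
  have h1 : stableTime N σ ≤ (SC * (growthConst N * sumAbs σ)) ^
      (atomExp N * signExp (atomOrder N)) := by
    have e : stableTime N σ = (SC * (growthConst N * sumAbs σ) ^ atomExp N) ^
        signExp (atomOrder N) := by rw [stableTime, hSCdef, mul_assoc]
    rw [e, pow_mul]
    refine Nat.pow_le_pow_left ?_ _
    rw [mul_pow SC]
    refine Nat.mul_le_mul_right _ ?_
    exact Nat.le_self_pow (by omega) _
  have hEE : atomExp N * signExp (atomOrder N) ≠ 0 := by positivity
  calc period N * (stableTime N σ + 1) ≤ period N * (2 * stableTime N σ) := by gcongr; omega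
    _ = (2 * period N) * stableTime N σ := by ring
    _ ≤ (2 * period N) ^ (atomExp N * signExp (atomOrder N)) *
        (SC * (growthConst N * sumAbs σ)) ^ (atomExp N * signExp (atomOrder N)) := by
        gcongr
        exact Nat.le_self_pow hEE _
    _ = (2 * period N * SC * growthConst N * sumAbs σ) ^
        (atomExp N * signExp (atomOrder N)) := by rw [← mul_pow]; ring
    _ ≤ (runtimeConst N * sumAbs σ) ^ (atomExp N * signExp (atomOrder N)) := by
        gcongr
        unfold runtimeConst
        rw [← hSCdef]
        exact Nat.le_add_right _ _
    _ ≤ _ := by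
        refine Nat.pow_le_pow_right (Nat.mul_pos ?_ hs) ?_
        · unfold runtimeConst
          exact Nat.add_pos_right _ (Nat.pos_of_ne_zero hEE)
        · unfold runtimeConst
          exact Nat.le_add_left _ _

/-- A violation later than `stableTime` in its residue class can be moved back to the representative
of that class just after `stableTime`, which lies within the bound. -/
theorem exists_guard_false (h : L.BoundedBy N) (hL : L.IsPRS) (hT : L.Terminates)
    (σ : Fin d → ℤ) : ∃ n, n ≤ (runtimeConst N * sumAbs σ) ^ runtimeConst N ∧
      ¬ (L.iterGuard n).Holds σ := by
  by_contra! hcon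
  obtain ⟨n, hn⟩ := hT σ
  have hP := period_pos N
  have hall : ∀ n ≤ period N * (stableTime N σ + 1), L.guard.Holds (L.step^[n] σ) := by
    intro n hn
    rw [← holds_iterGuard]
    exact hcon n (hn.trans (stableTime_le h.pos σ))
  rw [holds_iterGuard] at hn
  have hr := Nat.mod_lt n hP
  rcases le_total (stableTime N σ) (n / period N) with h1 | h1
  · rw [← Nat.div_add_mod n (period N), h.guard_constant hL σ _ hr _ h1] at hn
    exact hn (hall _ (by nlinarith))
  · refine hn (hall n ?_)
    have h2 := Nat.div_add_mod n (period N)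
    have h3 := Nat.mul_le_mul_left (period N) h1
    nlinarith

theorem rc_le (h : L.BoundedBy N) (hL : L.IsPRS) (hT : L.Terminates) (σ : Fin d → ℤ) :
    L.rc σ ≤ ((runtimeConst N * sumAbs σ) ^ runtimeConst N : ℕ) := by
  obtain ⟨n, hn, hf⟩ := h.exists_guard_false hL hT σ
  calc L.rc σ ≤ (n : ℕ∞) := sInf_le ⟨n, rfl, hf⟩
    _ ≤ _ := by exact_mod_cast hn

end Loop.BoundedBy

/-! ### Size bounds, polynomial for unit loops and a tower in general -/

/-- The order of the recurrences for the variables of a unit loop. -/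
def unitOrder (N : ℕ) : ℕ := 2 * levelMult 1 N N

/-- The constant of the polynomial size bound for unit loops. -/
def unitSizeConst (N : ℕ) : ℕ :=
  growthConst N * 4 ^ unitOrder N * (2 * runtimeConst N) +
    (growthExp N (period N * (unitOrder N + 1)) + 1 + (runtimeConst N + 1) * unitOrder N)

theorem one_le_runtimeConst {N : ℕ} (hN : 1 ≤ N) : 1 ≤ runtimeConst N := by
  have hE : 1 ≤ atomExp N := Nat.mul_pos (one_le_growthExp _ _) hN
  have hSE : 1 ≤ signExp (atomOrder N) := by
    unfold signExp; nlinarith [Nat.one_le_pow (atomOrder N) (atomOrder N + 3) (by omega)]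
  exact Nat.add_pos_right _ (Nat.mul_pos hE hSE)

namespace Loop.BoundedBy

variable {d : ℕ} {L : Loop d} {N : ℕ}

/-- A passed test puts the orbit in a class with base 1, hence polynomial growth in n with a
constant polynomial in σ; and n itself is at most polynomial in σ. -/
theorem natAbs_iterate_le_of_unitTest (h : L.BoundedBy N) (hL : L.IsPRS) (hU : L.UnitTest N)
    (σ : Fin d → ℤ) (i : Fin d) {n : ℕ}
    (hn : n ≤ (runtimeConst N * sumAbs σ) ^ runtimeConst N) :
    ((L.step^[n] σ) i).natAbs ≤ (unitSizeConst N * sumAbs σ) ^ unitSizeConst N := by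
  obtain ⟨S, -⟩ := hL
  have hs := one_le_sumAbs σ
  have hc : 1 ≤ growthConst N := by unfold growthConst; omega
  have hK := one_le_runtimeConst h.pos
  have hcls := orbit_mem_cls S h.pos le_rfl h.dim_le (fun i => (h.update i).1)
    (hU.exists_pow_period_eq S) σ i
  rw [one_pow] at hcls
  have h1 := abs_le_of_mem_cls_one (period_pos N) hcls
    (M := (growthConst N * sumAbs σ) ^ growthExp N (period N * (unitOrder N + 1)))
    (fun n hn => by
      rw [Int.abs_eq_natAbs]
      exact_mod_cast h.natAbs_iterate_le σ hn.le i) n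
  change _ ≤ _ * 4 ^ unitOrder N * (n + 1 : ℤ) ^ unitOrder N at h1
  set E := growthExp N (period N * (unitOrder N + 1)) with hE
  set K := runtimeConst N with hKd
  set s := sumAbs σ with hsd
  have h2 : ((L.step^[n] σ) i).natAbs ≤
      (growthConst N * s) ^ E * 4 ^ unitOrder N * (n + 1) ^ unitOrder N := by
    rw [Int.abs_eq_natAbs] at h1
    exact_mod_cast h1
  have hKs : 1 ≤ K * s := Nat.mul_pos hK hs
  have h3 : n + 1 ≤ (2 * K * s) ^ (K + 1) := by
    calc n + 1 ≤ (K * s) ^ K + (K * s) ^ K := Nat.add_le_add hn (Nat.one_le_pow _ _ hKs)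
      _ = 2 * (K * s) ^ K := by ring
      _ ≤ (2 * K * s) * (2 * K * s) ^ K := by gcongr <;> nlinarith
      _ = _ := by ring
  set b := growthConst N * 4 ^ unitOrder N * (2 * K) with hb
  have h4 : 1 ≤ 4 ^ unitOrder N := Nat.one_le_pow _ _ (by omega)
  have hbs : 1 ≤ b * s := Nat.mul_pos (by positivity) hs
  have b1 : growthConst N * s ≤ b * s := by
    gcongr
    calc growthConst N = growthConst N * 1 * 1 := by ring
      _ ≤ b := by rw [hb]; gcongr; omega
  have b2 : 4 ^ unitOrder N ≤ b * s := by
    calc 4 ^ unitOrder N = 1 * 4 ^ unitOrder N * 1 * 1 := by ring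
      _ ≤ b * s := by rw [hb]; gcongr; omega
  have b3 : 2 * K * s ≤ b * s := by
    gcongr
    calc 2 * K = 1 * 1 * (2 * K) := by ring
      _ ≤ b := by rw [hb]; gcongr
  calc _ ≤ _ := h2
    _ ≤ (b * s) ^ E * (b * s) * ((b * s) ^ (K + 1)) ^ unitOrder N := by
        gcongr
        exact h3.trans (Nat.pow_le_pow_left b3 _)
    _ = (b * s) ^ (E + 1 + (K + 1) * unitOrder N) := by rw [← pow_mul, ← pow_succ, ← pow_add]
    _ ≤ (b * s) ^ unitSizeConst N := Nat.pow_le_pow_right hbs (Nat.le_add_left _ _)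
    _ ≤ _ := by
        gcongr
        exact Nat.le_add_right _ _

/-- Needs no eigenvalues: only the degree growth per iteration and x ≤ 2^x. -/
theorem natAbs_iterate_le_of_le (h : L.BoundedBy N)
    (σ : Fin d → ℤ) (i : Fin d) {n r : ℕ} (hn : n ≤ r) :
    ((L.step^[n] σ) i).natAbs ≤
      2 ^ (growthConst N * sumAbs σ * (2 * growthConst N) ^ r) := by
  refine (h.natAbs_iterate_le σ hn i).trans ?_
  rw [pow_mul]
  exact Nat.pow_le_pow_left Nat.lt_two_pow_self.le _

end Loop.BoundedBy

/-! ### Bounds for loops in terms of their descriptions -/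

theorem monomialOf_eq (R : Type) [CommSemiring R] (d : ℕ) (e : List ℕ) :
    monomialOf R d e =
      MvPolynomial.monomial (Finsupp.equivFunOnFinite.symm fun i : Fin d => e.getD i 0) 1 := by
  rw [MvPolynomial.monomial_eq, Finsupp.prod_fintype _ _ (by simp)]
  simp [monomialOf]

theorem totalDegree_list_sum_le {d n : ℕ} (l : List (MvPolynomial (Fin d) ℤ))
    (h : ∀ q ∈ l, q.totalDegree ≤ n) : l.sum.totalDegree ≤ n := by
  induction l with
  | nil => simp
  | cons q l ih =>
    rw [List.sum_cons]
    exact (MvPolynomial.totalDegree_add _ _).trans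
      (max_le (h q (by simp)) (ih fun r hr => h r (by simp [hr])))

theorem abs_list_sum_le {m : ℕ} (l : List ℤ) (h : ∀ a ∈ l, |a| ≤ m) :
    |l.sum| ≤ l.length * m := by
  induction l with
  | nil => simp
  | cons a l ih =>
    rw [List.sum_cons, List.length_cons]
    have h1 := h a (by simp)
    have h2 := ih fun r hr => h r (by simp [hr])
    have h3 := abs_add_le a l.sum
    push_cast
    linarith

theorem totalDegree_intPolyOf_le {d n : ℕ} (l : List (ℤ × List ℕ))
    (h : ∀ t ∈ l, ∀ k, t.2.getD k 0 ≤ n) : (intPolyOf d l).totalDegree ≤ d * n := by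
  refine totalDegree_list_sum_le _ fun q hq => ?_
  obtain ⟨t, ht, rfl⟩ := List.mem_map.1 hq
  refine (MvPolynomial.totalDegree_mul _ _).trans ?_
  rw [MvPolynomial.totalDegree_C, zero_add, monomialOf]
  refine (MvPolynomial.totalDegree_finsetProd _ _).trans ?_
  calc _ ≤ ∑ _i : Fin d, n := by
        refine Finset.sum_le_sum fun i _ => ?_
        rw [MvPolynomial.totalDegree_X_pow]
        exact h t ht i
    _ = d * n := by simp

theorem eval_intPolyOf {d : ℕ} (l : List (ℤ × List ℕ)) (σ : Fin d → ℤ) :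
    MvPolynomial.eval σ (intPolyOf d l) =
      (l.map fun t => t.1 * ∏ i, σ i ^ t.2.getD i 0).sum := by
  rw [intPolyOf, map_list_sum, List.map_map]
  congr 1
  refine List.map_congr_left fun t _ => ?_
  simp [monomialOf]

theorem eval_ratPolyOf {d : ℕ} (l : List ((ℤ × ℕ) × List ℕ)) (σ : Fin d → ℤ) :
    MvPolynomial.eval (fun i => (σ i : ℚ)) (ratPolyOf d l) =
      (l.map fun t => (t.1.1 : ℚ) / (t.1.2 + 1) * ∏ i, (σ i : ℚ) ^ t.2.getD i 0).sum := by
  rw [ratPolyOf, map_list_sum, List.map_map]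
  congr 1
  refine List.map_congr_left fun t _ => ?_
  simp only [Function.comp_apply, monomialOf, map_mul, MvPolynomial.eval_C, map_prod, map_pow,
    MvPolynomial.eval_X]

theorem coeff_intPolyOf {d : ℕ} (l : List (ℤ × List ℕ)) (m : Fin d →₀ ℕ) :
    (intPolyOf d l).coeff m =
      (l.map fun t => if ∀ i : Fin d, t.2.getD i 0 = m i then t.1 else 0).sum := by
  rw [intPolyOf, ← MvPolynomial.lcoeff_apply (R := ℤ), map_list_sum, List.map_map]
  congr 1
  refine List.map_congr_left fun t _ => ?_
  rw [Function.comp_apply, MvPolynomial.lcoeff_apply, MvPolynomial.coeff_C_mul, monomialOf_eq,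
    MvPolynomial.coeff_monomial]
  have : (Finsupp.equivFunOnFinite.symm (fun i : Fin d => t.2.getD i 0) = m) ↔
      ∀ i : Fin d, t.2.getD i 0 = m i := by
    rw [Finsupp.ext_iff]; rfl
  simp only [this]
  split_ifs <;> simp

theorem abs_coeff_intPolyOf_le {d m : ℕ} (l : List (ℤ × List ℕ)) (h : ∀ t ∈ l, |t.1| ≤ m)
    (e : Fin d →₀ ℕ) : |(intPolyOf d l).coeff e| ≤ l.length * m := by
  rw [coeff_intPolyOf]
  refine (abs_list_sum_le (m := m) _ fun a ha => ?_).trans_eq (by rw [List.length_map])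
  obtain ⟨t, ht, rfl⟩ := List.mem_map.1 ha
  split_ifs
  · exact h t ht
  · simp

theorem natAbs_eval_intPolyOf_le {d m n : ℕ} (l : List (ℤ × List ℕ)) (h : ∀ t ∈ l, |t.1| ≤ m)
    (h' : ∀ t ∈ l, ∀ k, t.2.getD k 0 ≤ n) (σ : Fin d → ℤ) :
    (MvPolynomial.eval σ (intPolyOf d l)).natAbs ≤ l.length * (m * sumAbs σ ^ (d * n)) := by
  have : |MvPolynomial.eval σ (intPolyOf d l)| ≤
      l.length * ((m * sumAbs σ ^ (d * n) : ℕ) : ℤ) := by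
    rw [eval_intPolyOf]
    refine (abs_list_sum_le (m := m * sumAbs σ ^ (d * n)) _ fun a ha => ?_).trans_eq
      (by rw [List.length_map])
    obtain ⟨t, ht, rfl⟩ := List.mem_map.1 ha
    rw [abs_mul, Finset.abs_prod]
    push_cast
    refine mul_le_mul (h t ht) ?_ (Finset.prod_nonneg fun _ _ => abs_nonneg _) (by positivity)
    calc _ ≤ ∏ _i : Fin d, (sumAbs σ : ℤ) ^ n := by
          refine Finset.prod_le_prod (fun _ _ => abs_nonneg _) fun i _ => ?_
          rw [abs_pow]
          have h1 : |σ i| ≤ sumAbs σ := by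
            rw [Int.abs_eq_natAbs]; exact_mod_cast natAbs_le_sumAbs σ i
          have h2 : (1 : ℤ) ≤ sumAbs σ := by exact_mod_cast one_le_sumAbs σ
          exact (pow_le_pow_left₀ (abs_nonneg _) h1 _).trans (pow_le_pow_right₀ h2 (h' t ht i))
      _ = _ := by rw [Finset.prod_const, Finset.card_univ, Fintype.card_fin, ← pow_mul, mul_comm]
  rw [Int.abs_eq_natAbs] at this
  exact_mod_cast this

theorem polyBoundedBy_intPolyOf {d a m n N : ℕ} (l : List (ℤ × List ℕ)) (hl : l.length ≤ a)
    (h : ∀ t ∈ l, |t.1| ≤ m) (h' : ∀ t ∈ l, ∀ k, t.2.getD k 0 ≤ n) (h1 : a * m ≤ N)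
    (h2 : d * n ≤ N) : PolyBoundedBy N (intPolyOf d l) := by
  refine ⟨(totalDegree_intPolyOf_le l h').trans h2, fun σ => ?_⟩
  refine (natAbs_eval_intPolyOf_le l h h' σ).trans ?_
  rw [← mul_assoc]
  have hs := one_le_sumAbs σ
  gcongr
  exact (Nat.mul_le_mul_right m hl).trans h1

/-- The common denominator of the described polynomial. -/
def commonDenom (l : List ((ℤ × ℕ) × List ℕ)) : ℕ := (l.map fun t => t.1.2 + 1).prod

/-- Multiplication of a rational polynomial with its common denominator. -/
def clearDenom (l : List ((ℤ × ℕ) × List ℕ)) : List (ℤ × List ℕ) :=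
  l.map fun t => (t.1.1 * (commonDenom l / (t.1.2 + 1) : ℕ), t.2)

theorem commonDenom_pos (l : List ((ℤ × ℕ) × List ℕ)) : 0 < commonDenom l := by
  refine List.prod_pos fun a ha => ?_
  obtain ⟨t, _, rfl⟩ := List.mem_map.1 ha
  omega

theorem commonDenom_le {n : ℕ} (l : List ((ℤ × ℕ) × List ℕ)) (h : ∀ t ∈ l, t.1.2 ≤ n) :
    commonDenom l ≤ (n + 1) ^ l.length := by
  induction l with
  | nil => simp [commonDenom]
  | cons t l ih =>
    have h1 := ih fun r hr => h r (by simp [hr])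
    have h2 := h t (by simp)
    rw [commonDenom, List.map_cons, List.prod_cons, List.length_cons, pow_succ']
    exact Nat.mul_le_mul (by omega) h1

theorem eval_clearDenom {d : ℕ} (l : List ((ℤ × ℕ) × List ℕ)) (σ : Fin d → ℤ) :
    (MvPolynomial.eval σ (intPolyOf d (clearDenom l)) : ℚ) =
      commonDenom l * MvPolynomial.eval (fun i => (σ i : ℚ)) (ratPolyOf d l) := by
  rw [eval_intPolyOf, eval_ratPolyOf, clearDenom, List.map_map, ← List.sum_map_mul_left]
  rw [Int.cast_list_sum, List.map_map]
  congr 1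
  refine List.map_congr_left fun t ht => ?_
  have hd : (t.1.2 + 1) ∣ commonDenom l :=
    List.dvd_prod (List.mem_map.2 ⟨t, ht, rfl⟩)
  have h0 : ((t.1.2 : ℚ) + 1) ≠ 0 := by positivity
  have e : ((commonDenom l / (t.1.2 + 1) : ℕ) : ℚ) = commonDenom l / (t.1.2 + 1) := by
    rw [Nat.cast_div hd (by exact_mod_cast h0)]; push_cast; rfl
  simp only [Function.comp_apply, Int.cast_mul, Int.cast_natCast, e,
    Int.cast_prod, Int.cast_pow]
  ring

/-- The common denominator is positive, so guard atoms may be replaced by integer polynomials, whose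
values along an orbit are integer sequences. -/
theorem zero_lt_eval_ratPolyOf_iff {d : ℕ} (l : List ((ℤ × ℕ) × List ℕ)) (σ : Fin d → ℤ) :
    0 < MvPolynomial.eval (fun i => (σ i : ℚ)) (ratPolyOf d l) ↔
      0 < MvPolynomial.eval σ (intPolyOf d (clearDenom l)) := by
  have h : (0 : ℚ) < commonDenom l := by exact_mod_cast commonDenom_pos l
  rw [← Int.cast_pos (R := ℚ), eval_clearDenom, mul_pos_iff_of_pos_left h]

theorem natAbs_le_encode (z : ℤ) : z.natAbs ≤ Encodable.encode z := by
  cases z with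
  | ofNat k =>
    change k ≤ 2 * k
    omega
  | negSucc k =>
    change k + 1 ≤ 2 * k + 1
    omega

theorem encode_le_of_mem {α : Type} [Encodable α] {l : List α} {a : α} (h : a ∈ l) :
    Encodable.encode a ≤ Encodable.encode l := by
  induction l with
  | nil => simp at h
  | cons b l ih =>
    rw [Encodable.encode_list_cons]
    rcases List.mem_cons.1 h with rfl | h
    · exact (Nat.left_le_pair _ _).trans (Nat.le_succ _)
    · exact (ih h).trans ((Nat.right_le_pair _ _).trans (Nat.le_succ _))

theorem encode_fst_le {α β : Type} [Encodable α] [Encodable β] (a : α × β) :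
    Encodable.encode a.1 ≤ Encodable.encode a := by
  rw [Encodable.encode_prod_val]; exact Nat.left_le_pair _ _

theorem encode_snd_le {α β : Type} [Encodable α] [Encodable β] (a : α × β) :
    Encodable.encode a.2 ≤ Encodable.encode a := by
  rw [Encodable.encode_prod_val]; exact Nat.right_le_pair _ _

theorem getD_le_encode (l : List ℕ) (k : ℕ) : l.getD k 0 ≤ Encodable.encode l := by
  rcases lt_or_ge k l.length with h | h
  · rw [List.getD_eq_getElem _ _ h]
    exact encode_le_of_mem (l.getElem_mem h)
  · rw [List.getD_eq_default _ _ h]; exact Nat.zero_le _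

theorem encode_getD_le {α : Type} [Encodable α] (l : List (List α)) (k : ℕ) :
    Encodable.encode (l.getD k []) ≤ Encodable.encode l := by
  rcases lt_or_ge k l.length with h | h
  · rw [List.getD_eq_getElem _ _ h]
    exact encode_le_of_mem (l.getElem_mem h)
  · rw [List.getD_eq_default _ _ h]; simp

/-- The bound for a loop that is computed from the number of its description. -/
def repBound (n : ℕ) : ℕ := (n + 1) ^ (n + 2)

theorem sq_mul_le_repBound (n : ℕ) : n * (n * (n + 1) ^ n) ≤ repBound n := by
  unfold repBound
  calc n * (n * (n + 1) ^ n) ≤ (n + 1) * ((n + 1) * (n + 1) ^ n) := by gcongr <;> omega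
    _ = _ := by ring

theorem sq_le_repBound (n : ℕ) : n * n ≤ repBound n :=
  (Nat.mul_le_mul_left n (Nat.le_mul_of_pos_right n (by positivity))).trans (sq_mul_le_repBound n)

theorem forall_map_ratPolyOf {d n : ℕ} (hd : d ≤ n) (φ : Formula (List ((ℤ × ℕ) × List ℕ)))
    (h : Encodable.encode φ ≤ n) :
    (φ.map (ratPolyOf d)).Forall fun p => ∃ g : MvPolynomial (Fin d) ℤ,
      PolyBoundedBy (repBound n) g ∧ ∀ σ : Fin d → ℤ,
        0 < MvPolynomial.eval (fun i => (σ i : ℚ)) p ↔ 0 < MvPolynomial.eval σ g := by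
  induction φ with
  | pos l =>
    have hl : Encodable.encode l ≤ n := by
      have : 3 * Encodable.encode l ≤ n := h
      omega
    have hlen : l.length ≤ n := (Encodable.length_le_encode l).trans hl
    have hm : ∀ t ∈ l, Encodable.encode t ≤ n := fun t ht => (encode_le_of_mem ht).trans hl
    have hden : commonDenom l ≤ (n + 1) ^ n :=
      (commonDenom_le l fun t ht => ((encode_snd_le t.1).trans (encode_fst_le t)).trans
        (hm t ht)).trans (Nat.pow_le_pow_right (by omega) hlen)
    refine ⟨intPolyOf d (clearDenom l), ?_, fun σ => zero_lt_eval_ratPolyOf_iff l σ⟩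
    -- Clearing denominators multiplies a coefficient of size at most n by at most (n + 1)^n; there
    -- are at most n terms.
    refine polyBoundedBy_intPolyOf (a := n) (m := n * (n + 1) ^ n) (n := n) _ ?_ ?_ ?_
      (sq_mul_le_repBound n) ((Nat.mul_le_mul_right n hd).trans (sq_le_repBound n))
    · rw [clearDenom, List.length_map]; exact hlen
    · intro t ht
      obtain ⟨t, ht', rfl⟩ := List.mem_map.1 ht
      rw [abs_mul, Nat.abs_cast, Int.abs_eq_natAbs]
      have h1 : t.1.1.natAbs ≤ n := (((natAbs_le_encode t.1.1).trans (encode_fst_le t.1)).trans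
        (encode_fst_le t)).trans (hm t ht')
      have h2 := Nat.mul_le_mul h1 ((Nat.div_le_self (commonDenom l) (t.1.2 + 1)).trans hden)
      exact_mod_cast h2
    · intro t ht k
      obtain ⟨t, ht', rfl⟩ := List.mem_map.1 ht
      exact ((getD_le_encode t.2 k).trans (encode_snd_le t)).trans (hm t ht')
  | and φ ψ h1 h2 =>
    have : 3 * Nat.pair (Encodable.encode φ) (Encodable.encode ψ) + 1 ≤ n := h
    have l1 := Nat.left_le_pair (Encodable.encode φ) (Encodable.encode ψ)
    have l2 := Nat.right_le_pair (Encodable.encode φ) (Encodable.encode ψ)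
    exact ⟨h1 (by omega), h2 (by omega)⟩
  | or φ ψ h1 h2 =>
    have : 3 * Nat.pair (Encodable.encode φ) (Encodable.encode ψ) + 2 ≤ n := h
    have l1 := Nat.left_le_pair (Encodable.encode φ) (Encodable.encode ψ)
    have l2 := Nat.right_le_pair (Encodable.encode φ) (Encodable.encode ψ)
    exact ⟨h1 (by omega), h2 (by omega)⟩

/-- The code of a description is at least as large as every number, list length and exponent
occurring in it, so one number computed from it bounds all the data. -/
theorem boundedBy_repBound (d : ℕ) (c : LoopRep) :
    (c.toLoop d).BoundedBy (repBound (Encodable.encode (d, c))) := by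
  set n := Encodable.encode (d, c) with hn
  have hd : d ≤ n := encode_fst_le (d, c)
  have hc : Encodable.encode c ≤ n := encode_snd_le (d, c)
  have hl : ∀ i : Fin d, Encodable.encode (c.2.getD i []) ≤ n := fun i =>
    ((encode_getD_le c.2 i).trans (encode_snd_le c)).trans hc
  have hlen : ∀ i : Fin d, (c.2.getD i []).length ≤ n := fun i =>
    (Encodable.length_le_encode _).trans (hl i)
  have hm : ∀ i : Fin d, ∀ t ∈ c.2.getD i [], Encodable.encode t ≤ n := fun i t ht =>
    (encode_le_of_mem ht).trans (hl i)
  have hcoef : ∀ i : Fin d, ∀ t ∈ c.2.getD i [], |t.1| ≤ n := fun i t ht => by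
    rw [Int.abs_eq_natAbs]
    exact_mod_cast ((natAbs_le_encode t.1).trans (encode_fst_le t)).trans (hm i t ht)
  refine ⟨Nat.one_le_pow _ _ (by omega), ?_, fun i => ?_, fun i k => ?_, ?_⟩
  · calc d ≤ n + 1 := by omega
      _ ≤ _ := Nat.le_self_pow (by omega) _
  · exact polyBoundedBy_intPolyOf (a := n) (m := n) (n := n) _ (hlen i) (hcoef i)
      (fun t ht k => ((getD_le_encode t.2 k).trans (encode_snd_le t)).trans (hm i t ht))
      (sq_le_repBound n) ((Nat.mul_le_mul_right n hd).trans (sq_le_repBound n))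
  · rw [Loop.jac, Matrix.of_apply]
    refine (abs_coeff_intPolyOf_le _ (hcoef i) _).trans ?_
    exact_mod_cast (Nat.mul_le_mul_right n (hlen i)).trans (sq_le_repBound n)
  · exact forall_map_ratPolyOf hd c.1 ((encode_fst_le c).trans hc)

/-! ### Primitive recursiveness -/

section Primrec

variable {α : Type*} [Primcodable α] {f g h : α → ℕ}

theorem primrec_add (hf : Primrec f) (hg : Primrec g) : Primrec fun a => f a + g a :=
  Primrec.nat_add.comp hf hg

theorem primrec_mul (hf : Primrec f) (hg : Primrec g) : Primrec fun a => f a * g a :=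
  Primrec.nat_mul.comp hf hg

theorem primrec_pow (hf : Primrec f) (hg : Primrec g) : Primrec fun a => f a ^ g a :=
  (Primrec₂.unpaired'.1 Nat.Primrec.pow).comp hf hg

theorem primrec_factorial (hf : Primrec f) : Primrec fun a => (f a).factorial := by
  have : Primrec Nat.factorial := by
    refine (Primrec.nat_rec₁ (f := fun n k : ℕ => (n + 1) * k) 1
      (primrec_mul (primrec_add Primrec.fst (Primrec.const 1)) Primrec.snd)).of_eq fun n => ?_
    induction n with
    | zero => rfl
    | succ n ih => rw [Nat.factorial_succ, ← ih]
  exact this.comp hf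

theorem primrec_period (hf : Primrec f) : Primrec fun a => period (f a) :=
  primrec_mul (primrec_factorial hf) (primrec_factorial (primrec_mul (Primrec.const 2) hf))

theorem primrec_prodMult (hf : Primrec f) (hg : Primrec g) (hh : Primrec h) :
    Primrec fun a => prodMult (f a) (g a) (h a) := by
  refine (Primrec.nat_rec' (f := h) (g := fun _ => 1)
    (h := fun a p => (f a + 1) * g a + (f a ^ p.1 + 1) * p.2) hh (Primrec.const 1) ?_).of_eq ?_
  · have c1 := Primrec.const (α := α × ℕ × ℕ) 1
    have hp : Primrec fun x : α × ℕ × ℕ => x.2.1 := Primrec.fst.comp Primrec.snd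
    have hq : Primrec fun x : α × ℕ × ℕ => x.2.2 := Primrec.snd.comp Primrec.snd
    exact primrec_add (primrec_mul (primrec_add (hf.comp Primrec.fst) c1) (hg.comp Primrec.fst))
      (primrec_mul (primrec_add (primrec_pow (hf.comp Primrec.fst) hp) c1) hq)
  · intro a
    induction h a with
    | zero => rfl
    | succ n ih => rw [prodMult, ← ih]

theorem primrec_levelMult (hf : Primrec f) (hg : Primrec g) (hh : Primrec h) :
    Primrec fun a => levelMult (f a) (g a) (h a) := by
  refine (Primrec.nat_rec' (f := h) (g := fun _ => 0)
    (h := fun a p => prodMult (f a ^ g a ^ p.1) p.2 (g a) + g a) hh (Primrec.const 0) ?_).of_eq ?_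
  · have hp : Primrec fun x : α × ℕ × ℕ => x.2.1 := Primrec.fst.comp Primrec.snd
    have hq : Primrec fun x : α × ℕ × ℕ => x.2.2 := Primrec.snd.comp Primrec.snd
    have hg' : Primrec fun x : α × ℕ × ℕ => g x.1 := hg.comp Primrec.fst
    exact primrec_add (primrec_prodMult (primrec_pow (hf.comp Primrec.fst) (primrec_pow hg' hp))
      hq hg') hg'
  · intro a
    induction h a with
    | zero => rfl
    | succ n ih => rw [levelMult, ← ih]

theorem primrec_signConst (hf : Primrec f) (hg : Primrec g) :
    Primrec fun a => signConst (f a) (g a) := by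
  have c : ∀ n : ℕ, Primrec fun _ : α => n := fun n => Primrec.const n
  have f1 := primrec_add hf (c 1)
  have g1 := primrec_add hg (c 1)
  have ff := primrec_pow (primrec_mul (c 2) f1) hg
  exact primrec_add (primrec_add (primrec_add hg (c 2))
    (primrec_mul (primrec_mul (primrec_mul (primrec_mul (c 2)
      (primrec_mul (primrec_mul (c 2) (primrec_pow f1 (primrec_mul (c 2) hg))) ff))
      (primrec_pow (c 2) hg)) (primrec_factorial g1)) (primrec_pow (primrec_mul (c 2) hf) g1)))
    (primrec_mul (primrec_mul (primrec_mul (c 2) (primrec_pow f1 hg)) (primrec_pow hf hg))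
      (primrec_mul (primrec_pow f1 hg) ff))

theorem primrec_signExp (hf : Primrec f) : Primrec fun a => signExp (f a) :=
  primrec_mul (Primrec.const 2) (primrec_pow (primrec_add hf (Primrec.const 3)) hf)

theorem primrec_growthConst (hf : Primrec f) : Primrec fun a => growthConst (f a) :=
  primrec_add (primrec_pow hf (Primrec.const 2)) (Primrec.const 1)

theorem primrec_growthExp (hf : Primrec f) (hg : Primrec g) :
    Primrec fun a => growthExp (f a) (g a) :=
  primrec_pow (primrec_mul (Primrec.const 2) (primrec_growthConst hf)) hg

theorem primrec_eigBound (hf : Primrec f) : Primrec fun a => eigBound (f a) :=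
  primrec_pow hf (primrec_mul (Primrec.const 2) (primrec_period hf))

theorem primrec_eigBound_pow (hf : Primrec f) : Primrec fun a => eigBound (f a) ^ f a ^ f a :=
  primrec_pow (primrec_eigBound hf) (primrec_pow hf hf)

theorem primrec_atomBase (hf : Primrec f) : Primrec fun a => atomBase (f a) :=
  primrec_pow (primrec_eigBound_pow hf) hf

theorem primrec_atomMult (hf : Primrec f) : Primrec fun a => atomMult (f a) :=
  primrec_prodMult (primrec_eigBound_pow hf) (primrec_levelMult (primrec_eigBound hf) hf hf) hf

theorem primrec_atomOrder (hf : Primrec f) : Primrec fun a => atomOrder (f a) :=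
  primrec_mul (primrec_add (primrec_atomBase hf) (Primrec.const 1)) (primrec_atomMult hf)

theorem primrec_atomExp (hf : Primrec f) : Primrec fun a => atomExp (f a) :=
  primrec_mul (primrec_growthExp hf (primrec_mul (primrec_period hf)
    (primrec_add (primrec_atomOrder hf) (Primrec.const 1)))) hf

theorem primrec_runtimeConst (hf : Primrec f) : Primrec fun a => runtimeConst (f a) :=
  primrec_add (primrec_mul (primrec_mul (primrec_mul (Primrec.const 2) (primrec_period hf))
    (primrec_mul (primrec_signConst (primrec_atomBase hf) (primrec_atomOrder hf)) hf))
    (primrec_growthConst hf)) (primrec_mul (primrec_atomExp hf)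
    (primrec_signExp (primrec_atomOrder hf)))

theorem primrec_unitOrder (hf : Primrec f) : Primrec fun a => unitOrder (f a) :=
  primrec_mul (Primrec.const 2) (primrec_levelMult (Primrec.const 1) hf hf)

theorem primrec_unitSizeConst (hf : Primrec f) : Primrec fun a => unitSizeConst (f a) :=
  have c1 := Primrec.const (α := α) 1
  primrec_add (primrec_mul (primrec_mul (primrec_growthConst hf)
    (primrec_pow (Primrec.const 4) (primrec_unitOrder hf)))
    (primrec_mul (Primrec.const 2) (primrec_runtimeConst hf)))
    (primrec_add (primrec_add (primrec_growthExp hf (primrec_mul (primrec_period hf)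
      (primrec_add (primrec_unitOrder hf) c1))) c1)
      (primrec_mul (primrec_add (primrec_runtimeConst hf) c1) (primrec_unitOrder hf)))

theorem primrec_repBound (hf : Primrec f) : Primrec fun a => repBound (f a) :=
  primrec_pow (primrec_add hf (Primrec.const 1)) (primrec_add hf (Primrec.const 2))

/-! ### Integer arithmetic is primitive recursive -/

/-- Integers are coded by 2k for k and 2k + 1 for -k - 1. Arithmetic on ℤ is reduced to differences
of natural numbers. -/
theorem primrec_natSub_int : Primrec₂ fun a b : ℕ => (a : ℤ) - b := by
  have h : Primrec₂ fun a b : ℕ => if b ≤ a then 2 * (a - b) else 2 * (b - a - 1) + 1 := by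
    have ha : Primrec fun x : ℕ × ℕ => x.1 := Primrec.fst
    have hb : Primrec fun x : ℕ × ℕ => x.2 := Primrec.snd
    have c : ∀ n : ℕ, Primrec fun _ : ℕ × ℕ => n := fun n => Primrec.const n
    exact Primrec.ite (Primrec.nat_le.comp hb ha)
      (primrec_mul (c 2) (Primrec.nat_sub.comp ha hb))
      (primrec_add (primrec_mul (c 2) (Primrec.nat_sub.comp (Primrec.nat_sub.comp hb ha) (c 1)))
        (c 1))
  refine Primrec₂.encode_iff.1 (h.of_eq fun a b => ?_)
  split_ifs with hab
  · obtain ⟨k, rfl⟩ := Nat.exists_eq_add_of_le hab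
    have : ((b + k : ℕ) : ℤ) - b = Int.ofNat k := by push_cast; simp
    rw [this, Nat.add_sub_cancel_left]; rfl
  · obtain ⟨k, rfl⟩ := Nat.exists_eq_add_of_lt (not_le.1 hab)
    have : (a : ℤ) - ((a + k + 1 : ℕ) : ℤ) = Int.negSucc k := by
      rw [Int.negSucc_eq]; push_cast; ring
    rw [this]
    have e : a + k + 1 - a - 1 = k := by omega
    rw [e]; rfl

theorem primrec_toNat : Primrec Int.toNat := by
  have he : Primrec fun z : ℤ => Encodable.encode z := Primrec.encode
  refine (Primrec.ite (Primrec.eq.comp (Primrec.nat_mod.comp he (Primrec.const 2))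
    (Primrec.const 0)) (Primrec.nat_div.comp he (Primrec.const 2))
    (Primrec.const 0)).of_eq fun z => ?_
  cases z with
  | ofNat k =>
    have : Encodable.encode (Int.ofNat k) = 2 * k := rfl
    rw [this, if_pos (by omega)]
    simp
  | negSucc k =>
    have : Encodable.encode (Int.negSucc k) = 2 * k + 1 := rfl
    rw [this, if_neg (by omega)]
    rfl

theorem primrec_neg_toNat : Primrec fun z : ℤ => (-z).toNat := by
  have he : Primrec fun z : ℤ => Encodable.encode z := Primrec.encode
  refine (Primrec.ite (Primrec.eq.comp (Primrec.nat_mod.comp he (Primrec.const 2))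
    (Primrec.const 0)) (Primrec.const 0)
    (Primrec.nat_div.comp (primrec_add he (Primrec.const 1)) (Primrec.const 2))).of_eq fun z => ?_
  cases z with
  | ofNat k =>
    have : Encodable.encode (Int.ofNat k) = 2 * k := rfl
    rw [this, if_pos (by omega)]
    simp
  | negSucc k =>
    have : Encodable.encode (Int.negSucc k) = 2 * k + 1 := rfl
    rw [this, if_neg (by omega), Int.neg_negSucc]
    simp only [Int.toNat_natCast]
    omega

variable {x y : α → ℤ}

theorem primrec_int_add (hx : Primrec x) (hy : Primrec y) : Primrec fun a => x a + y a :=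
  (primrec_natSub_int.comp (primrec_add (primrec_toNat.comp hx) (primrec_toNat.comp hy))
    (primrec_add (primrec_neg_toNat.comp hx) (primrec_neg_toNat.comp hy))).of_eq fun a => by
    have h1 := Int.toNat_sub_toNat_neg (x a)
    have h2 := Int.toNat_sub_toNat_neg (y a)
    push_cast
    linarith

theorem primrec_int_sub (hx : Primrec x) (hy : Primrec y) : Primrec fun a => x a - y a :=
  (primrec_natSub_int.comp (primrec_add (primrec_toNat.comp hx) (primrec_neg_toNat.comp hy))
    (primrec_add (primrec_neg_toNat.comp hx) (primrec_toNat.comp hy))).of_eq fun a => by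
    have h1 := Int.toNat_sub_toNat_neg (x a)
    have h2 := Int.toNat_sub_toNat_neg (y a)
    push_cast
    linarith

theorem primrec_int_mul (hx : Primrec x) (hy : Primrec y) : Primrec fun a => x a * y a :=
  (primrec_natSub_int.comp
    (primrec_add (primrec_mul (primrec_toNat.comp hx) (primrec_toNat.comp hy))
      (primrec_mul (primrec_neg_toNat.comp hx) (primrec_neg_toNat.comp hy)))
    (primrec_add (primrec_mul (primrec_toNat.comp hx) (primrec_neg_toNat.comp hy))
      (primrec_mul (primrec_neg_toNat.comp hx) (primrec_toNat.comp hy)))).of_eq fun a => by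
    have h1 := Int.toNat_sub_toNat_neg (x a)
    have h2 := Int.toNat_sub_toNat_neg (y a)
    conv_rhs => rw [← h1, ← h2]
    push_cast
    ring

theorem primrec_int_list_sum {l : α → List ℤ} (hl : Primrec l) : Primrec fun a => (l a).sum :=
  (Primrec.list_foldr (h := fun _ p => p.1 + p.2) hl (Primrec.const 0)
    (primrec_int_add (Primrec.fst.comp Primrec.snd) (Primrec.snd.comp Primrec.snd))).of_eq
    fun a => by rw [List.sum]

end Primrec

/-! ### The test for unit loops is primitive recursive -/

/-- The entries of the Jacobian matrix, computed from a description. -/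
def jacRep (d : ℕ) (c : LoopRep) (i k : ℕ) : ℤ :=
  ((c.2.getD i []).map fun t =>
    if ∀ j < d, t.2.getD j 0 = if k = j then 1 else 0 then t.1 else 0).sum

theorem jac_toLoop (d : ℕ) (c : LoopRep) (i k : Fin d) :
    (c.toLoop d).jac i k = jacRep d c i k := by
  rw [Loop.jac, Matrix.of_apply, jacRep]
  change (intPolyOf d (c.2.getD i [])).coeff _ = _
  rw [coeff_intPolyOf]
  congr 2
  ext t
  have : (∀ j : Fin d, t.2.getD j 0 = (Finsupp.single k 1 : Fin d →₀ ℕ) j) ↔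
      ∀ j < d, t.2.getD j 0 = if (k : ℕ) = j then 1 else 0 := by
    simp only [Finsupp.single_apply, Fin.ext_iff]
    exact ⟨fun h j hj => h ⟨j, hj⟩, fun h j => h j j.2⟩
  simp only [this]

/-- Multiplication of a row vector with the Jacobian matrix. -/
def vecStep (d : ℕ) (c : LoopRep) (v : List ℤ) : List ℤ :=
  (List.range d).map fun k => ((List.range d).map fun l => v.getD l 0 * jacRep d c l k).sum

/-- Multiplication of a row vector with `J ^ P * (J ^ P - 1)` for the Jacobian matrix `J`. -/
def vecTest (d : ℕ) (c : LoopRep) (P : ℕ) (v : List ℤ) : List ℤ :=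
  (vecStep d c)^[P] ((List.range d).map fun k =>
    ((vecStep d c)^[P] v).getD k 0 - v.getD k 0)

theorem map_range_eq_ofFn {β : Type} (d : ℕ) (f : ℕ → β) :
    (List.range d).map f = List.ofFn fun i : Fin d => f i := by
  apply List.ext_getElem <;> simp

theorem getD_ofFn {d : ℕ} (v : Fin d → ℤ) (i : Fin d) : (List.ofFn v).getD i 0 = v i := by
  rw [List.getD_eq_getElem _ _ (by simp)]; simp

theorem vecStep_ofFn (d : ℕ) (c : LoopRep) (v : Fin d → ℤ) :
    vecStep d c (List.ofFn v) = List.ofFn (Matrix.vecMul v (c.toLoop d).jac) := by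
  rw [vecStep, map_range_eq_ofFn]
  congr 1
  ext k
  rw [map_range_eq_ofFn, List.sum_ofFn, Matrix.vecMul, dotProduct]
  simp only [getD_ofFn, jac_toLoop]

theorem vecStep_iterate_ofFn (d : ℕ) (c : LoopRep) (P : ℕ) (v : Fin d → ℤ) :
    (vecStep d c)^[P] (List.ofFn v) = List.ofFn (Matrix.vecMul v ((c.toLoop d).jac ^ P)) := by
  induction P with
  | zero => simp
  | succ P ih => rw [Function.iterate_succ_apply', ih, vecStep_ofFn, Matrix.vecMul_vecMul, pow_succ]

theorem vecTest_ofFn (d : ℕ) (c : LoopRep) (P : ℕ) (v : Fin d → ℤ) :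
    vecTest d c P (List.ofFn v) = List.ofFn
      (Matrix.vecMul v ((c.toLoop d).jac ^ P * ((c.toLoop d).jac ^ P - 1))) := by
  rw [vecTest, vecStep_iterate_ofFn, map_range_eq_ofFn]
  simp only [getD_ofFn]
  have : (fun i => Matrix.vecMul v ((c.toLoop d).jac ^ P) i - v i) =
      Matrix.vecMul v ((c.toLoop d).jac ^ P - 1) := by
    rw [Matrix.vecMul_sub, Matrix.vecMul_one]; rfl
  rw [this, vecStep_iterate_ofFn, Matrix.vecMul_vecMul]
  congr 2
  rw [mul_sub, sub_mul, mul_one, one_mul]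

theorem vecTest_iterate_ofFn (d : ℕ) (c : LoopRep) (P n : ℕ) (v : Fin d → ℤ) :
    (vecTest d c P)^[n] (List.ofFn v) = List.ofFn
      (Matrix.vecMul v (((c.toLoop d).jac ^ P * ((c.toLoop d).jac ^ P - 1)) ^ n)) := by
  induction n with
  | zero => simp
  | succ n ih => rw [Function.iterate_succ_apply', ih, vecTest_ofFn, Matrix.vecMul_vecMul, pow_succ]

/-- The computed form of the test for unit loops. -/
def unitTestRep (d : ℕ) (c : LoopRep) (N : ℕ) : Prop :=
  ∀ i < d, ∀ k < d, ((vecTest d c (period N))^[N]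
    ((List.range d).map fun j => if i = j then (1 : ℤ) else 0)).getD k 0 = 0

/-- Applying the operator to the unit row vectors yields the rows of the tested matrix power, so
lists of integers suffice and no matrices are encoded. -/
theorem unitTestRep_iff (d : ℕ) (c : LoopRep) (N : ℕ) :
    unitTestRep d c N ↔ (c.toLoop d).UnitTest N := by
  have key : ∀ i k : Fin d, ((vecTest d c (period N))^[N]
      ((List.range d).map fun j => if (i : ℕ) = j then (1 : ℤ) else 0)).getD k 0 =
      (((c.toLoop d).jac ^ period N * ((c.toLoop d).jac ^ period N - 1)) ^ N) i k := by
    intro i k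
    rw [map_range_eq_ofFn, vecTest_iterate_ofFn, getD_ofFn]
    have : (fun j : Fin d => if (i : ℕ) = j then (1 : ℤ) else 0) = Pi.single i 1 := by
      ext j; simp [Pi.single_apply, Fin.ext_iff, eq_comm]
    rw [this, Matrix.single_one_vecMul]; rfl
  constructor
  · intro h
    ext i k
    rw [← key]
    exact h i i.2 k k.2
  · intro h i hi k hk
    have := key ⟨i, hi⟩ ⟨k, hk⟩
    rw [Loop.UnitTest] at h
    rw [h] at this
    exact this

section Primrec

variable {α : Type} [Primcodable α]

theorem primrecRel_forall_lt {R : ℕ → α → Prop} (hR : PrimrecRel R) :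
    PrimrecRel fun n a => ∀ x < n, R x a :=
  (hR.forall_mem_list.comp (Primrec.list_range.comp Primrec.fst) Primrec.snd).of_eq
    fun a => by simp

theorem primrec_jacRep {d i k : α → ℕ} {c : α → LoopRep} (hd : Primrec d) (hc : Primrec c)
    (hi : Primrec i) (hk : Primrec k) : Primrec fun a => jacRep (d a) (c a) (i a) (k a) := by
  refine primrec_int_list_sum (Primrec.list_map
    ((Primrec.list_getD []).comp (Primrec.snd.comp hc) hi) ?_)
  have hR : PrimrecRel fun (j : ℕ) (p : α × (ℤ × List ℕ)) =>
      p.2.2.getD j 0 = if k p.1 = j then 1 else 0 := by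
    refine Primrec.eq.comp ((Primrec.list_getD 0).comp
      (Primrec.snd.comp (Primrec.snd.comp Primrec.snd)) Primrec.fst) ?_
    exact Primrec.ite (Primrec.eq.comp (hk.comp (Primrec.fst.comp Primrec.snd)) Primrec.fst)
      (Primrec.const 1) (Primrec.const 0)
  have hA := (primrecRel_forall_lt hR).comp (hd.comp Primrec.fst)
    (Primrec.id (α := α × (ℤ × List ℕ)))
  exact Primrec.ite hA (Primrec.fst.comp Primrec.snd) (Primrec.const 0)

theorem primrec_vecStep {d : α → ℕ} {c : α → LoopRep} {v : α → List ℤ} (hd : Primrec d)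
    (hc : Primrec c) (hv : Primrec v) : Primrec fun a => vecStep (d a) (c a) (v a) := by
  refine Primrec.list_map (Primrec.list_range.comp hd) ?_
  refine primrec_int_list_sum (Primrec.list_map (Primrec.list_range.comp (hd.comp Primrec.fst)) ?_)
  have h1 : Primrec fun x : (α × ℕ) × ℕ => x.1.1 := Primrec.fst.comp Primrec.fst
  exact primrec_int_mul ((Primrec.list_getD 0).comp (hv.comp h1) Primrec.snd)
    (primrec_jacRep (hd.comp h1) (hc.comp h1) Primrec.snd (Primrec.snd.comp Primrec.fst))

theorem primrec_vecStep_iterate {d P : α → ℕ} {c : α → LoopRep} {v : α → List ℤ}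
    (hd : Primrec d) (hc : Primrec c) (hP : Primrec P) (hv : Primrec v) :
    Primrec fun a => (vecStep (d a) (c a))^[P a] (v a) :=
  Primrec.nat_iterate hP hv
    (primrec_vecStep (hd.comp Primrec.fst) (hc.comp Primrec.fst) Primrec.snd)

theorem primrec_vecTest {d P : α → ℕ} {c : α → LoopRep} {v : α → List ℤ}
    (hd : Primrec d) (hc : Primrec c) (hP : Primrec P) (hv : Primrec v) :
    Primrec fun a => vecTest (d a) (c a) (P a) (v a) := by
  refine primrec_vecStep_iterate hd hc hP (Primrec.list_map (Primrec.list_range.comp hd) ?_)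
  exact primrec_int_sub
    ((Primrec.list_getD 0).comp ((primrec_vecStep_iterate hd hc hP hv).comp Primrec.fst)
      Primrec.snd)
    ((Primrec.list_getD 0).comp (hv.comp Primrec.fst) Primrec.snd)

theorem primrec_unitTest {d N : α → ℕ} {c : α → LoopRep} (hd : Primrec d) (hc : Primrec c)
    (hN : Primrec N) : PrimrecPred fun a => ((c a).toLoop (d a)).UnitTest (N a) := by
  have hv : Primrec fun x : ℕ × ℕ × α => (vecTest (d x.2.2) (c x.2.2) (period (N x.2.2)))^[N x.2.2]
      ((List.range (d x.2.2)).map fun j => if x.2.1 = j then (1 : ℤ) else 0) := by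
    have ha : Primrec fun x : ℕ × ℕ × α => x.2.2 := Primrec.snd.comp Primrec.snd
    refine Primrec.nat_iterate (hN.comp ha) (Primrec.list_map (Primrec.list_range.comp
      (hd.comp ha)) ?_) ?_
    · exact Primrec.ite (Primrec.eq.comp
        (Primrec.fst.comp (Primrec.snd.comp Primrec.fst)) Primrec.snd)
        (Primrec.const 1) (Primrec.const 0)
    · have ha' := ha.comp (Primrec.fst (β := List ℤ))
      exact primrec_vecTest (hd.comp ha') (hc.comp ha') (primrec_period (hN.comp ha')) Primrec.snd
  have h1 : PrimrecRel fun (k : ℕ) (p : ℕ × α) => ((vecTest (d p.2) (c p.2)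
      (period (N p.2)))^[N p.2] ((List.range (d p.2)).map fun j =>
        if p.1 = j then (1 : ℤ) else 0)).getD k 0 = 0 :=
    Primrec.eq.comp ((Primrec.list_getD 0).comp hv Primrec.fst) (Primrec.const 0)
  have h2 : PrimrecRel fun (i : ℕ) (a : α) => ∀ k < d a, ((vecTest (d a) (c a)
      (period (N a)))^[N a] ((List.range (d a)).map fun j =>
        if i = j then (1 : ℤ) else 0)).getD k 0 = 0 :=
    (primrecRel_forall_lt h1).comp (hd.comp Primrec.snd) Primrec.id
  exact ((primrecRel_forall_lt h2).comp hd Primrec.id).of_eq fun a => unitTestRep_iff _ _ _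

end Primrec

/-! ### The computed bounds -/

namespace Bound

variable {V W : Type}

/-- The bound `1 + ∑ v` over the variables in a list. -/
def sum (l : List V) : Bound V := l.foldr (fun v b => add (var v) b) (const 1)

/-- The power of a bound. -/
def pow (b : Bound V) (n : ℕ) : Bound V := n.rec (const 1) fun _ p => mul b p

/-- The bound `(K (1 + ∑ v)) ^ K`. -/
def poly (K : ℕ) (l : List V) : Bound V := pow (mul (const K) (sum l)) K

/-- The bound `2 ^ (c (1 + ∑ v) (2 c) ^ r)`. -/
def tower (c : ℕ) (l : List V) (r : Bound V) : Bound V :=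
  exp 2 (mul (mul (const c) (sum l)) (exp (2 * c) r))

theorem map_sum (f : V → W) (l : List V) : (sum l).map f = sum (l.map f) := by
  induction l with
  | nil => rfl
  | cons v l ih =>
    change add (var (f v)) (map f (sum l)) = _
    rw [ih]; rfl

theorem map_pow (f : V → W) (b : Bound V) (n : ℕ) : (pow b n).map f = pow (b.map f) n := by
  induction n with
  | zero => rfl
  | succ n ih =>
    change mul (map f b) (map f (pow b n)) = _
    rw [ih]; rfl

theorem map_poly (f : V → W) (K : ℕ) (l : List V) : (poly K l).map f = poly K (l.map f) := by
  rw [poly, map_pow, poly]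
  simp only [map, map_sum]

theorem map_tower (f : V → W) (c : ℕ) (l : List V) (r : Bound V) :
    (tower c l r).map f = tower c (l.map f) (r.map f) := by
  simp only [tower, map, map_sum]

theorem isPolynomial_sum (l : List V) : (sum l).IsPolynomial := by
  induction l with
  | nil => trivial
  | cons v l ih => exact ⟨trivial, ih⟩

theorem isPolynomial_pow {b : Bound V} (h : b.IsPolynomial) (n : ℕ) : (pow b n).IsPolynomial := by
  induction n with
  | zero => trivial
  | succ n ih => exact ⟨h, ih⟩

theorem isPolynomial_poly (K : ℕ) (l : List V) : (poly K l).IsPolynomial :=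
  isPolynomial_pow (b := mul (const K) (sum l)) ⟨trivial, isPolynomial_sum l⟩ K

theorem IsPolynomial.isFinite {b : Bound V} (h : b.IsPolynomial) : b.IsFinite := by
  induction b with
  | omega => exact h
  | const _ => trivial
  | var _ => trivial
  | add a b h1 h2 => exact ⟨h1 h.1, h2 h.2⟩
  | mul a b h1 h2 => exact ⟨h1 h.1, h2 h.2⟩
  | exp _ _ _ => exact h.elim

theorem isFinite_tower (c : ℕ) (l : List V) {r : Bound V} (h : r.IsFinite) :
    (tower c l r).IsFinite :=
  ⟨⟨trivial, (isPolynomial_sum l).isFinite⟩, h⟩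

theorem eval_sum {d : ℕ} (σ : Fin d → ℤ) :
    (sum (List.finRange d)).eval (fun j => (σ j).natAbs) = (sumAbs σ : ℕ) := by
  have : ∀ l : List (Fin d), (sum l).eval (fun j => (σ j).natAbs) =
      ((1 + (l.map fun j => (σ j).natAbs).sum : ℕ) : ℕ∞) := by
    intro l
    induction l with
    | nil => simp [sum, eval]
    | cons v l ih =>
      change ((σ v).natAbs : ℕ∞) + eval _ (sum l) = _
      rw [ih, List.map_cons, List.sum_cons]
      push_cast
      ring
  rw [this, sumAbs, ← List.ofFn_eq_map, List.sum_ofFn]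

theorem eval_pow (s : V → ℕ) (b : Bound V) (n : ℕ) : (pow b n).eval s = b.eval s ^ n := by
  induction n with
  | zero => simp [pow, eval]
  | succ n ih =>
    change b.eval s * (pow b n).eval s = _
    rw [ih, pow_succ']

theorem eval_poly {d : ℕ} (K : ℕ) (σ : Fin d → ℤ) :
    (poly K (List.finRange d)).eval (fun j => (σ j).natAbs) = ((K * sumAbs σ) ^ K : ℕ) := by
  rw [poly, eval_pow, eval, eval, eval_sum]; push_cast; rfl

theorem eval_tower {d : ℕ} (c K : ℕ) (σ : Fin d → ℤ) :
    (tower c (List.finRange d) (poly K (List.finRange d))).eval (fun j => (σ j).natAbs) =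
      (2 ^ (c * sumAbs σ * (2 * c) ^ (K * sumAbs σ) ^ K) : ℕ) := by
  simp only [tower, eval, eval_sum, eval_poly]
  rw [ENat.epow_natCast, ← Nat.cast_pow, ← Nat.cast_mul, ← Nat.cast_mul, ENat.epow_natCast,
    ← Nat.cast_pow]

section Primrec

variable {α : Type} [Primcodable α] {f : α → ℕ} {a b : α → Bound ℕ}

theorem primrec_const (hf : Primrec f) : Primrec fun x => (const (f x) : Bound ℕ) :=
  Primrec.encode_iff.1 (primrec_add (primrec_mul (Primrec.const 5) hf) (Primrec.const 1))

theorem primrec_var (hf : Primrec f) : Primrec fun x => (var (f x) : Bound ℕ) :=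
  Primrec.encode_iff.1 (primrec_add (primrec_mul (Primrec.const 5) hf) (Primrec.const 2))

theorem primrec_add (ha : Primrec a) (hb : Primrec b) : Primrec fun x => add (a x) (b x) :=
  Primrec.encode_iff.1 (PRS.primrec_add (primrec_mul (Primrec.const 5)
    (Primrec₂.natPair.comp (Primrec.encode.comp ha) (Primrec.encode.comp hb))) (Primrec.const 3))

theorem primrec_mul (ha : Primrec a) (hb : Primrec b) : Primrec fun x => mul (a x) (b x) :=
  Primrec.encode_iff.1 (PRS.primrec_add (PRS.primrec_mul (Primrec.const 5)
    (Primrec₂.natPair.comp (Primrec.encode.comp ha) (Primrec.encode.comp hb))) (Primrec.const 4))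

theorem primrec_exp (hf : Primrec f) (hb : Primrec b) : Primrec fun x => exp (f x) (b x) :=
  Primrec.encode_iff.1 (PRS.primrec_add (PRS.primrec_mul (Primrec.const 5)
    (Primrec₂.natPair.comp hf (Primrec.encode.comp hb))) (Primrec.const 5))

theorem primrec_sum {l : α → List ℕ} (hl : Primrec l) : Primrec fun x => sum (l x) :=
  Primrec.list_foldr (h := fun _ p => add (var p.1) p.2) hl (Primrec.const (const 1))
    (primrec_add (primrec_var (Primrec.fst.comp Primrec.snd)) (Primrec.snd.comp Primrec.snd))

theorem primrec_pow (hb : Primrec b) (hf : Primrec f) : Primrec fun x => pow (b x) (f x) :=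
  Primrec.nat_rec' (h := fun x p => mul (b x) p.2) hf (Primrec.const (const 1))
    (primrec_mul (hb.comp Primrec.fst) (Primrec.snd.comp Primrec.snd))

theorem primrec_poly {l : α → List ℕ} (hf : Primrec f) (hl : Primrec l) :
    Primrec fun x => poly (f x) (l x) :=
  primrec_pow (primrec_mul (primrec_const hf) (primrec_sum hl)) hf

theorem primrec_tower {l : α → List ℕ} (hf : Primrec f) (hl : Primrec l) (hb : Primrec b) :
    Primrec fun x => tower (f x) (l x) (b x) :=
  primrec_exp (Primrec.const 2) (primrec_mul (primrec_mul (primrec_const hf) (primrec_sum hl))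
    (primrec_exp (PRS.primrec_mul (Primrec.const 2) hf) hb))

end Primrec

end Bound

/-- The number that bounds the loop with a given description. -/
def inputBound (a : ℕ × LoopRep) : ℕ := repBound (Encodable.encode a)

theorem primrec_inputBound : Primrec inputBound := primrec_repBound Primrec.encode

/-- The computed runtime bound. -/
def runtimeBound (a : ℕ × LoopRep) : Bound ℕ :=
  Bound.poly (runtimeConst (inputBound a)) (List.range a.1)

theorem primrec_runtimeBound : Primrec runtimeBound :=
  Bound.primrec_poly (primrec_runtimeConst primrec_inputBound)
    (Primrec.list_range.comp Primrec.fst)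

open Classical in
/-- The computed size bound. -/
noncomputable def sizeBound (a : ℕ × LoopRep) : Bound ℕ :=
  if (a.2.toLoop a.1).UnitTest (inputBound a) then
    Bound.poly (unitSizeConst (inputBound a)) (List.range a.1)
  else Bound.tower (growthConst (inputBound a)) (List.range a.1) (runtimeBound a)

/-- The classical case distinction is effective because the unit test is a primitive recursive
predicate. -/
theorem primrec_sizeBound : Primrec sizeBound := by
  classical
  have hr : Primrec fun a : ℕ × LoopRep => List.range a.1 := Primrec.list_range.comp Primrec.fst
  exact Primrec.ite (primrec_unitTest Primrec.fst Primrec.snd primrec_inputBound)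
    (Bound.primrec_poly (primrec_unitSizeConst primrec_inputBound) hr)
    (Bound.primrec_tower (primrec_growthConst primrec_inputBound) hr primrec_runtimeBound)

theorem primrec_replicate_sizeBound :
    Primrec fun a : ℕ × LoopRep => List.replicate a.1 (sizeBound a) :=
  (Primrec.list_map (g := fun a _ => sizeBound a) (Primrec.list_range.comp Primrec.fst)
    (primrec_sizeBound.comp Primrec.fst)).of_eq fun a => by simp

theorem isSizeBound_of_forall {d : ℕ} {L : Loop d} {s : Fin d → Bound (Fin d)} {r : (Fin d → ℤ) → ℕ}
    (hr : ∀ σ, L.rc σ ≤ r σ)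
    (h : ∀ i σ n, n ≤ r σ →
      (((L.step^[n] σ) i).natAbs : ℕ∞) ≤ (s i).eval fun j => (σ j).natAbs) :
    L.IsSizeBound s := by
  intro i σ
  refine sSup_le ?_
  rintro t ⟨n, hn, rfl⟩
  rw [Loop.eval_iter]
  exact h i σ n (by exact_mod_cast hn.trans (hr σ))

end PRS

/-! ### The main theorem -/

open PRS in
theorem mainTheorem1 :
    ∃ (rb : ℕ × PRS.LoopRep →. PRS.Bound ℕ) (sb : ℕ × PRS.LoopRep →. List (PRS.Bound ℕ)),
      Partrec rb ∧ Partrec sb ∧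
      ∀ (d : ℕ) (L : PRS.Loop d) (c : PRS.LoopRep), c.toLoop d = L →
        L.Terminates → L.IsPRS →
          (∃ r : PRS.Bound (Fin d),
            r.map (fun i : Fin d => (i : ℕ)) ∈ rb (d, c) ∧
            L.IsRuntimeBound r ∧ r.IsPolynomial) ∧
          (∃ s : Fin d → PRS.Bound (Fin d),
            (List.ofFn fun i => (s i).map (fun j : Fin d => (j : ℕ))) ∈ sb (d, c) ∧
            L.IsSizeBound s ∧ (∀ i, (s i).IsFinite) ∧
            (L.IsUnitPRS → ∀ i, (s i).IsPolynomial)) := by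
  refine ⟨fun a => Part.some (runtimeBound a),
    fun a => Part.some (List.replicate a.1 (sizeBound a)), primrec_runtimeBound.to_comp.partrec,
    primrec_replicate_sizeBound.to_comp.partrec, ?_⟩
  rintro d L c rfl hT hL
  set N := inputBound (d, c) with hN
  have hb : (c.toLoop d).BoundedBy N := boundedBy_repBound d c
  have hvars : (List.finRange d).map (fun i : Fin d => (i : ℕ)) = List.range d := by simp
  have hrc := hb.rc_le hL hT
  refine ⟨⟨Bound.poly (runtimeConst N) (List.finRange d), ?_, fun σ => ?_,
    Bound.isPolynomial_poly _ _⟩, ?_⟩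
  · rw [Bound.map_poly, hvars]
    exact Part.mem_some _
  · rw [Bound.eval_poly]
    exact hrc σ
  -- The output branches on the decidable test. A unit loop always passes it, so the tower is never
  -- returned for one.
  by_cases hU : (c.toLoop d).UnitTest N
  · refine ⟨fun _ => Bound.poly (unitSizeConst N) (List.finRange d), ?_,
      isSizeBound_of_forall hrc fun i σ n hn => ?_,
      fun _ => (Bound.isPolynomial_poly _ _).isFinite, fun _ _ => Bound.isPolynomial_poly _ _⟩
    · rw [List.ofFn_const, Bound.map_poly, hvars]
      simp only [sizeBound, ← hN, if_pos hU]
      exact Part.mem_some _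
    · rw [Bound.eval_poly]
      exact_mod_cast hb.natAbs_iterate_le_of_unitTest hL hU σ i hn
  · refine ⟨fun _ => Bound.tower (growthConst N) (List.finRange d)
        (Bound.poly (runtimeConst N) (List.finRange d)), ?_,
      isSizeBound_of_forall hrc fun i σ n hn => ?_,
      fun _ => Bound.isFinite_tower _ _ (Bound.isPolynomial_poly _ _).isFinite,
      fun h => absurd (Loop.unitTest_of_isUnitPRS h hb.dim_le) hU⟩
    · rw [List.ofFn_const, Bound.map_tower, Bound.map_poly, hvars]
      simp only [sizeBound, ← hN, if_neg hU]
      exact Part.mem_some _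
    · rw [Bound.eval_tower]
      exact_mod_cast hb.natAbs_iterate_le_of_le σ i hn
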